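/- **Setting.** Let $d\ge 2$ and let $\lambda$ satisfy $0<\lambda<\dfrac{(2d-1)^{2d-1}}{(2d-2)^{2d}}$. Regard $\mathbb{Z}^d$ as a graph in which nodes at $\ell^1$-distance $1$ are adjacent. For finite $\Lambda\subset\mathbb{Z}^d$ let $Z_\Lambda=\sum_I\lambda^{|I|}$, the sum being over all independent sets $I\subset\Lambda$, and let $\partial\Lambda$ be the set of nodes of $\Lambda$ with a neighbour outside $\Lambda$. The *free energy* is $$\mathcal{P}=\mathcal{P}(d,\lambda)=\lim_{n\to\infty}\frac{\log Z_{\Lambda_n}}{|\Lambda_n|}$$ along any sequence of finite non-empty sets $\Lambda_n\subset\mathbb{Z}^d$ with $|\partial\Lambda_n|/|\Lambda_n|\to0$. For $a\in\mathbb{R}_{>0}^d$ put $B_{an}=\{u\in\mathbb{Z}^d:|u_j|\le a_jn,\ 1\le j\le d\}$, $A_j(a)=\prod_{k\ne j}2a_k$ and $A(a)=\sum_jA_j(a)$; the *surface pressure* is $$s\mathcal{P}=s\mathcal{P}(d,\lambda,a)=\lim_{n\to\infty}\frac{\log Z_{B_{an}}-|B_{an}|\,\mathcal{P}}{A(a)\,n^{d-1}}.$$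 **Algorithm.** For a subgraph $G$ of $\mathbb{Z}^d$ induced by a set $V$ of nodes, $v\in V$ and $t\ge0$ let $\Phi_G(v,0)=1$ and $$\Phi_G(v,t+1)=\Big(1+\lambda\prod_{i=1}^{k}\Phi_{G_{i-1}}(v_i,t)\Big)^{-1},$$ where $v_1,\dots,v_k$ are the neighbours of $v$ in $G$ (taken in the order $v-e_1,v+e_1,\dots,v-e_d,v+e_d$), $G_i$ is induced by $V\setminus\{v,v_1,\dots,v_i\}$, and an empty product is $1$. Let $\Psi_G$ satisfy the same recursion with $\Psi_G(v,0)=0$. Order $\mathbb{Z}^d$ by $v\prec u$ iff for some $k$ we have $v_k<u_k$ and $v_j=u_j$ for all $j>k$. Let $\Phi(t),\Psi(t)$ be the values $\Phi_G(0,t),\Psi_G(0,t)$ for the graph $G$ on the nodes $v\preceq0$, and $\Phi_{j,k,+}(t)$, $\Phi_{j,k,-}(t)$ the values $\Phi_G(0,t)$ for the graphs $G$ on the nodes $v\preceq0$ with $v_j\le k$, respectively with $v_j\ge-k$. The sequential cavity algorithm (SCA) with a constant $c\in\mathbb{N}$, on input $\epsilon>0$, computes $t=c(m+1)$, where $m\ge0$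 is the least integer with $2^{-m}\le\epsilon$, evaluates the above recursions, and returns * for the free energy, the two bounds $L=-\log\Phi(2t)$ and $U=-\log\Psi(2t)$; * for the surface pressure, $\displaystyle S=\sum_{j=1}^d\frac{A_j(a)}{A(a)}\sum_{k=0}^{t-1}\big(2\log\Phi(2t)-\log\Phi_{j,k,+}(2t)-\log\Phi_{j,k,-}(2t)\big).$ Its running time is the number of elementary steps of this recursive evaluation: arithmetic operations, logarithms and comparisons of real numbers, operations on integers (coordinates of nodes and loop counters), steps of list traversal (the removed nodes are kept in a list that is searched), and procedure calls, each counted as one step. **Proposition 2.** The limits defining $\mathcal{P}(d,\lambda)$ and, for every $a\in\mathbb{R}_{>0}^d$, $s\mathcal{P}(d,\lambda,a)$ exist. There are constants $c,C\in\mathbb{N}$ depending only on $d$ and $\lambda$ such that for every $\epsilon>0$ the SCA with constant $c$ produces, in time at most $\max(2,1/\epsilon)^{C}$ (that is, $(1/\epsilon)^{O(1)}$), numbers $L\le\mathcal{P}(d,\lambda)\le U$ with $U-L\le\epsilon$, so that every number of $[L,U]$ is an $\epsilon$-additive estimate of $\mathcal{P}(d,\lambda)$; and for every $a\in\mathbb{R}_{>0}^d$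 it produces, in time at most $\max(2,1/\epsilon)^{C}$, a number $S$ with $|S-s\mathcal{P}(d,\lambda,a)|\le\epsilon$. -/

import Mathlib

namespace HardCore

/-! ### The lattice and the hard-core model on it -/

/-- Nodes of the lattice `ℤ^d`. -/
abbrev Node (d : ℕ) : Type := Fin d → ℤ

/-- The lattice `ℤ^d` as a graph: nodes at `ℓ¹`-distance one are adjacent. -/
def lattice (d : ℕ) : SimpleGraph (Node d) where
  Adj v u := ∑ i, |v i - u i| = 1
  symm := ⟨fun v u h => by simpa only [abs_sub_comm] using h⟩
  loopless := ⟨fun v h => by simp at h⟩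

open Classical in
/-- The hard-core partition function of the subgraph of `ℤ^d` induced by the finite set `Λ`:
the sum of `lam ^ |I|` over the independent sets `I` contained in `Λ`. -/
noncomputable def partitionFunction (d : ℕ) (lam : ℝ) (Λ : Finset (Node d)) : ℝ :=
  ∑ I ∈ Λ.powerset.filter
      (fun I : Finset (Node d) => (lattice d).IsIndepSet (↑I : Set (Node d))), lam ^ I.card

open Classical in
/-- The boundary of `Λ`: the nodes of `Λ` that have a neighbour outside `Λ`. -/
noncomputable def boundary {d : ℕ} (Λ : Finset (Node d)) : Finset (Node d) :=
  Λ.filter fun v => ∃ u, (lattice d).Adj v u ∧ u ∉ Λ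

/-- `P` is the free energy (pressure) of the hard-core model with activity `lam` on `ℤ^d`:
`log Z_Λ / |Λ|` tends to `P` along every sequence of finite non-empty sets whose boundary is
negligible with respect to their volume. -/
def HasFreeEnergy (d : ℕ) (lam P : ℝ) : Prop :=
  ∀ Λ : ℕ → Finset (Node d), (∀ n, (Λ n).Nonempty) →
    Filter.Tendsto (fun n => ((boundary (Λ n)).card : ℝ) / ((Λ n).card : ℝ))
      Filter.atTop (nhds 0) →
    Filter.Tendsto (fun n => Real.log (partitionFunction d lam (Λ n)) / ((Λ n).card : ℝ))
      Filter.atTop (nhds P)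

/-- The rectangle `B_{an} = {u : |u_j| ≤ a_j n for all j}`. -/
noncomputable def rectangle {d : ℕ} (a : Fin d → ℝ) (n : ℕ) : Finset (Node d) :=
  Fintype.piFinset fun j => Finset.Icc (-⌊a j * n⌋) ⌊a j * n⌋

/-- `A_j(a) = ∏_{k ≠ j} 2 a_k`. -/
noncomputable def faceArea {d : ℕ} (a : Fin d → ℝ) (j : Fin d) : ℝ :=
  ∏ k ∈ Finset.univ.erase j, 2 * a k

/-- `A(a) = ∑_j A_j(a)`. -/
noncomputable def totalArea {d : ℕ} (a : Fin d → ℝ) : ℝ := ∑ j, faceArea a j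

/-- `s` is the surface pressure for the rectangular shape `a`, where `P` is the free energy:
the limit of `A(a)⁻¹ n^{-(d-1)} (log Z_{B_{an}} - |B_{an}| P)`. -/
def HasSurfacePressure (d : ℕ) (lam P : ℝ) (a : Fin d → ℝ) (s : ℝ) : Prop :=
  Filter.Tendsto
    (fun n : ℕ => (Real.log (partitionFunction d lam (rectangle a n))
        - ((rectangle a n).card : ℝ) * P) / (totalArea a * (n : ℝ) ^ (d - 1)))
    Filter.atTop (nhds s)

/-! ### Computations with a step count

A computation is a value together with the number of elementary steps that were spent on it.
Elementary steps are: one arithmetic operation, logarithm or comparison on real numbers, one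
operation on machine integers (such as the coordinates of a node and loop counters), one step of
list traversal, and one procedure call. -/

/-- A value together with the number of elementary steps spent on computing it. -/
structure Timed (α : Type) where
  /-- the result -/
  val : α
  /-- the number of elementary steps -/
  cost : ℕ

/-- Sequential composition adds the step counts. -/
instance : Monad Timed where
  pure x := ⟨x, 0⟩
  bind x f := ⟨(f x.val).val, x.cost + (f x.val).cost⟩

namespace Timed

/-- Spend `n` elementary steps. -/
def spend (n : ℕ) : Timed Unit := ⟨(), n⟩

/-- Addition, one step. -/
noncomputable def add (x y : ℝ) : Timed ℝ := ⟨x + y, 1⟩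

/-- Subtraction, one step. -/
noncomputable def sub (x y : ℝ) : Timed ℝ := ⟨x - y, 1⟩

/-- Multiplication, one step. -/
noncomputable def mul (x y : ℝ) : Timed ℝ := ⟨x * y, 1⟩

/-- Division, one step. -/
noncomputable def div (x y : ℝ) : Timed ℝ := ⟨x / y, 1⟩

/-- Natural logarithm, one step. -/
noncomputable def log (x : ℝ) : Timed ℝ := ⟨Real.log x, 1⟩

/-- The sum of the computed values `f i` along a list. -/
noncomputable def sum {ι : Type} (f : ι → Timed ℝ) : List ι → Timed ℝ
  | [] => do
      spend 1
      return 0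
  | i :: l => do
      spend 1
      let x ← f i
      let y ← sum f l
      add x y

/-- The product of the computed values `f i` along a list. -/
noncomputable def prod {ι : Type} (f : ι → Timed ℝ) : List ι → Timed ℝ
  | [] => do
      spend 1
      return 1
  | i :: l => do
      spend 1
      let x ← f i
      let y ← prod f l
      mul x y

end Timed

/-! ### The sequential cavity algorithm -/

/-- The lexicographic order on `ℤ^d` in which the last coordinate is the most significant. -/
def LexLT {d : ℕ} (v u : Node d) : Prop :=
  ∃ k, v k < u k ∧ ∀ j, k < j → v j = u j

/-- The whole lattice, and the half-spaces `{v : v_j ≤ k}` and `{v : v_j ≥ -k}`. -/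
inductive Domain (d : ℕ) : Type where
  | whole : Domain d
  | upper (j : Fin d) (k : ℕ) : Domain d
  | lower (j : Fin d) (k : ℕ) : Domain d

/-- The nodes of a domain. -/
def Domain.nodes {d : ℕ} : Domain d → Set (Node d)
  | .whole => Set.univ
  | .upper j k => {v | v j ≤ (k : ℤ)}
  | .lower j k => {v | -(k : ℤ) ≤ v j}

/-- The nodes of a domain that precede the origin lexicographically, and the origin itself. -/
def Domain.cavityNodes {d : ℕ} (D : Domain d) : Set (Node d) :=
  {v | v ∈ D.nodes ∧ (LexLT v 0 ∨ v = 0)}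

open Classical in
/-- Test whether a node lies in the cavity region of a domain: the coordinates are compared
with zero one by one, and one of them with the bound of the half-space. -/
noncomputable def testRegion {d : ℕ} (D : Domain d) (w : Node d) : Timed Bool :=
  ⟨decide (w ∈ D.cavityNodes), 2 * d + 2⟩

/-- Test whether a node occurs in a list, coordinate by coordinate. -/
def testMem {d : ℕ} (w : Node d) : List (Node d) → Timed Bool
  | [] => do
      Timed.spend 1
      return false
  | u :: l => do
      Timed.spend (d + 1)
      if u = w then return true else testMem w l

/-- The neighbours `v - e_i`, `v + e_i` (`i = 1, …, d`) of `v` in `ℤ^d`; each is written down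
coordinate by coordinate. -/
def listNeighbors {d : ℕ} (v : Node d) : Timed (List (Node d)) :=
  ⟨(List.finRange d).flatMap fun i =>
      [Function.update v i (v i - 1), Function.update v i (v i + 1)], 2 * d * (d + 2) + 1⟩

/-- Runs through a list of candidates. The current graph is the region of `D` without the nodes
in `removed`. Each candidate `w` in the current graph contributes the factor computed by
`child removed w`, and is then removed from the graph. -/
noncomputable def childProduct {d : ℕ} (D : Domain d)
    (child : List (Node d) → Node d → Timed ℝ) :
    List (Node d) → List (Node d) → Timed ℝ
  | [], _ => do
      Timed.spend 1
      return 1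
  | w :: ws, removed => do
      Timed.spend 1
      let inside ← testRegion D w
      let gone ← testMem w removed
      if inside = true ∧ gone = false then do
        let x ← child removed w
        let y ← childProduct D child ws (w :: removed)
        Timed.mul x y
      else
        childProduct D child ws removed

/-- The cavity recursion. For the graph `G` induced by the nodes of the region of `D` that are
not in `removed`, a node `v` of `G` and a depth `t`, it computes
`Φ_G(v, 0) = init` and `Φ_G(v, t + 1) = 1 / (1 + lam * ∏_{i ≤ k} Φ_{G_{i-1}}(v_i, t))`, where
`v_1, …, v_k` are the neighbours of `v` in `G` and `G_i` is `G` without `v, v_1, …, v_i`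
(the empty product is `1`). The initial value is `1` for `Φ` and `0` for `Ψ`. -/
noncomputable def cavity {d : ℕ} (D : Domain d) (lam init : ℝ) :
    ℕ → List (Node d) → Node d → Timed ℝ
  | 0, _, _ => do
      Timed.spend 1
      return init
  | t + 1, removed, v => do
      Timed.spend 1
      let ws ← listNeighbors v
      let p ← childProduct D (cavity D lam init t) ws (v :: removed)
      let q ← Timed.mul lam p
      let r ← Timed.add 1 q
      Timed.div 1 r

/-- The logarithm of `Φ` (for `init = 1`) or `Ψ` (for `init = 0`) at the origin of the cavity
region of `D`, at depth `t`. -/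
noncomputable def logCavity {d : ℕ} (D : Domain d) (lam init : ℝ) (t : ℕ) : Timed ℝ := do
  let x ← cavity D lam init t [] 0
  Timed.log x

/-- The level `t = c (m + 1)`, where `m` is the least number with `2^{-m} ≤ ε`. Starting from
`1`, one halves until the result is at most `ε`, and counts the halvings. -/
noncomputable def level (c : ℕ) (ε : ℝ) : Timed ℕ :=
  let m := sInf {m : ℕ | (1 / 2 : ℝ) ^ m ≤ ε}
  ⟨c * (m + 1), 3 * m + 3⟩

/-- The sequential cavity algorithm for the free energy. With `t` the level for accuracy `ε`, it
returns the bounds `-log Φ(2t)` and `-log Ψ(2t)`. -/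
noncomputable def scaFreeEnergy (d : ℕ) (lam : ℝ) (c : ℕ) (ε : ℝ) : Timed (ℝ × ℝ) := do
  let t ← level c ε
  Timed.spend 1
  let x ← logCavity (Domain.whole : Domain d) lam 1 (2 * t)
  let y ← logCavity (Domain.whole : Domain d) lam 0 (2 * t)
  let lo ← Timed.sub 0 x
  let hi ← Timed.sub 0 y
  return (lo, hi)

/-- Computes `A_j(a)`. -/
noncomputable def computeFaceArea {d : ℕ} (a : Fin d → ℝ) (j : Fin d) : Timed ℝ :=
  Timed.prod (fun k => do
    Timed.spend 1
    if k = j then return 1 else Timed.mul 2 (a k)) (List.finRange d)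

/-- The sequential cavity algorithm for the surface pressure. With `t` the level for accuracy
`ε`, it returns
`∑_j (A_j(a) / A(a)) ∑_{k < t} (2 log Φ(2t) - log Φ_{j,k,+}(2t) - log Φ_{j,k,-}(2t))`,
where `Φ_{j,k,±}` refers to the half-spaces `v_j ≤ k` and `v_j ≥ -k`. -/
noncomputable def scaSurfacePressure (d : ℕ) (lam : ℝ) (a : Fin d → ℝ) (c : ℕ) (ε : ℝ) :
    Timed ℝ := do
  let t ← level c ε
  Timed.spend 1
  let x ← logCavity (Domain.whole : Domain d) lam 1 (2 * t)
  let total ← Timed.sum (computeFaceArea a) (List.finRange d)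
  Timed.sum (fun j => do
    let area ← computeFaceArea a j
    let weight ← Timed.div area total
    let s ← Timed.sum (fun k => do
      let up ← logCavity (Domain.upper j k) lam 1 (2 * t)
      let low ← logCavity (Domain.lower j k) lam 1 (2 * t)
      let z ← Timed.mul 2 x
      let z' ← Timed.sub z up
      Timed.sub z' low) (List.range t)
    Timed.mul weight s) (List.finRange d)

end HardCore

/-!
Write each marginal vacancy probability as `p = 1 / cosh² θ`. In the coordinate `θ` the cavity
recursion has partial derivatives `-tanh Θ · tanh θ_i`. A node with a missing neighbour has at most
`2d - 1` children, and below the critical activity of the tree with that branching the `ℓ¹` norm of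
this gradient stays uniformly below `1`, so the recursion forgets its boundary values geometrically
fast.

Removing nodes in lexicographic order telescopes `log Z` into a sum of local energies, each
of which is determined up to a geometric error by the region near the node. Deep nodes contribute
the free energy, nodes near a single face the excess over it at their depth below that face, and the
nodes near two faces only `o(n^(d-1))` in total. Since the recursion reverses order, its even
iterates from the initial values `1` and `0` bracket the limit.
-/

namespace HardCore

section Contraction

/-- The critical activity `b ^ b / (b - 1) ^ (b + 1)` of the hard-core model on the infinite tree
in which every node has `b` children. -/
noncomputable def criticalActivity (b : ℕ) : ℝ := (b : ℝ) ^ b / (b - 1) ^ (b + 1)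

/-- The factor by which the cavity recursion at a node with at most `b` children contracts distances
in the coordinate `angle`. -/
noncomputable def contractionRate (b : ℕ) (lam : ℝ) : ℝ :=
  √((lam / criticalActivity b + lam) / (1 + lam))

variable {b : ℕ} {lam : ℝ} {ι : Type*} [Fintype ι]

theorem contractionRate_lt_one (hlam : 0 ≤ lam) (hlam' : lam < criticalActivity b) :
    contractionRate b lam < 1 := by
  have h := (div_lt_one (hlam.trans_lt hlam')).2 hlam'
  rw [contractionRate, Real.sqrt_lt' one_pos, one_pow, div_lt_one (by linarith)]
  linarith

theorem sq_contractionRate (hlam : 0 ≤ lam) (hlam' : lam < criticalActivity b) :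
    contractionRate b lam ^ 2 = (lam / criticalActivity b + lam) / (1 + lam) := by
  have := hlam.trans_lt hlam'
  exact Real.sq_sqrt (by positivity)

theorem pow_mul_sub_le_one (b : ℕ) {y : ℝ} (hy : 0 < y) : y ^ b * (b + 1 - b * y) ≤ 1 := by
  have bernoulli : 1 + (b + 1 : ℕ) * (y⁻¹ - 1) ≤ y⁻¹ ^ (b + 1) :=
    one_add_mul_sub_le_pow (by linarith [inv_pos.2 hy]) (b + 1)
  calc y ^ b * (b + 1 - b * y) = y ^ (b + 1) * (1 + (b + 1 : ℕ) * (y⁻¹ - 1)) := by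
        push_cast
        field_simp
        ring
    _ ≤ y ^ (b + 1) * y⁻¹ ^ (b + 1) := by gcongr
    _ = 1 := by rw [← mul_pow, mul_inv_cancel₀ hy.ne', one_pow]

theorem sq_mul_criticalActivity_mul_le (hb : 2 ≤ b) {q : ℝ} (hq : 0 ≤ q) :
    (b : ℝ) ^ 2 * (1 - q) * (criticalActivity b * q ^ b) ≤ 1 + criticalActivity b * q ^ b := by
  rcases hq.eq_or_lt with rfl | hq
  · simp [show b ≠ 0 by lia]
  have hb1 : (0 : ℝ) < b - 1 := by
    have : (2 : ℝ) ≤ b := mod_cast hb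
    linarith
  have hbq : 0 < b * q / (b - 1 : ℝ) := by positivity
  have key : (b * q / (b - 1) : ℝ) ^ b * (b + 1 - b * (b * q / (b - 1)))
      = criticalActivity b * q ^ b * ((b : ℝ) ^ 2 * (1 - q) - 1) := by
    rw [criticalActivity, div_pow, mul_pow, pow_succ]
    field_simp
    ring
  linarith [pow_mul_sub_le_one b hbq]

theorem sq_mul_le_sq_contractionRate_mul (hb : 2 ≤ b) (hlam : 0 ≤ lam)
    (hlam' : lam < criticalActivity b) {q : ℝ} (hq : 0 ≤ q) (hq1 : q ≤ 1) :
    (b : ℝ) ^ 2 * (1 - q) * (lam * q ^ b) ≤ contractionRate b lam ^ 2 * (1 + lam * q ^ b) := by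
  have hc : 0 < criticalActivity b := hlam.trans_lt hlam'
  have hr : lam / criticalActivity b ≤ 1 := (div_le_one hc).2 hlam'.le
  have hx : q ^ b ≤ 1 := pow_le_one₀ hq hq1
  calc (b : ℝ) ^ 2 * (1 - q) * (lam * q ^ b)
      = lam / criticalActivity b * ((b : ℝ) ^ 2 * (1 - q) * (criticalActivity b * q ^ b)) := by
        field_simp
    _ ≤ lam / criticalActivity b * (1 + criticalActivity b * q ^ b) := by
        gcongr
        exact sq_mul_criticalActivity_mul_le hb hq
    _ = lam / criticalActivity b + lam * q ^ b := by field_simp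
    _ ≤ contractionRate b lam ^ 2 * (1 + lam * q ^ b) := by
        rw [sq_contractionRate hlam hlam', div_mul_eq_mul_div, le_div_iff₀ (by linarith)]
        nlinarith [mul_nonneg (mul_nonneg hlam (sub_nonneg.2 hr)) (sub_nonneg.2 hx)]

theorem prod_one_sub_le_pow (hb : 0 < b) (hcard : Fintype.card ι ≤ b) {x : ι → ℝ}
    (hx : ∀ i, x i ≤ 1) : ∏ i, (1 - x i) ≤ (1 - (∑ i, x i) / b) ^ b := by
  have hb' : (0 : ℝ) < b := mod_cast hb
  have hcard' : (Fintype.card ι : ℝ) / b ≤ 1 := (div_le_one hb').2 (mod_cast hcard)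
  have hx' : ∀ i, 0 ≤ 1 - x i := fun i => sub_nonneg.2 (hx i)
  -- The extra index carries the `b - card ι` missing factors, which are equal to one.
  have amgm : ∏ i, (1 - x i) ^ (b : ℝ)⁻¹ ≤ 1 - (∑ i, x i) / b := by
    have h := Real.geom_mean_le_arith_mean_weighted (ι := Option ι) Finset.univ
      (fun i => i.elim (1 - Fintype.card ι / b) fun _ => (b : ℝ)⁻¹)
      (fun i => i.elim 1 fun i => 1 - x i)
      (by rintro (_ | i) - <;> simp [hcard']) (by simp [Fintype.sum_option]; field_simp; ring)
      (by rintro (_ | i) - <;> simp [hx])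
    simp only [Fintype.prod_option, Fintype.sum_option, Option.elim_none, Option.elim_some,
      Real.one_rpow, one_mul, mul_one, ← Finset.mul_sum, Finset.sum_sub_distrib] at h
    refine h.trans_eq ?_
    simp only [Finset.sum_const, Finset.card_univ, nsmul_eq_mul, mul_one]
    ring
  calc ∏ i, (1 - x i) = (∏ i, (1 - x i) ^ (b : ℝ)⁻¹) ^ b := by
        rw [← Finset.prod_pow]
        exact Finset.prod_congr rfl fun i _ => (Real.rpow_inv_natCast_pow (hx' i) hb.ne').symm
    _ ≤ (1 - (∑ i, x i) / b) ^ b :=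
        pow_le_pow_left₀ (Finset.prod_nonneg fun i _ => Real.rpow_nonneg (hx' i) _) amgm b

theorem sq_sum_abs_mul_le (hb : 2 ≤ b) (hcard : Fintype.card ι ≤ b) (hlam : 0 ≤ lam)
    (hlam' : lam < criticalActivity b) {x : ι → ℝ} (hx : ∀ i, x i ^ 2 ≤ 1) :
    (∑ i, |x i|) ^ 2 * (lam * ∏ i, (1 - x i ^ 2))
      ≤ contractionRate b lam ^ 2 * (1 + lam * ∏ i, (1 - x i ^ 2)) := by
  have hb0 : (0 : ℝ) < b := mod_cast (by lia : 0 < b)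
  have hcard' : (Fintype.card ι : ℝ) ≤ b := mod_cast hcard
  set q := 1 - (∑ i, x i ^ 2) / b with hq
  have hq0 : 0 ≤ q := by
    rw [hq, sub_nonneg, div_le_one hb0]
    calc ∑ i, x i ^ 2 ≤ ∑ _i : ι, 1 := Finset.sum_le_sum fun i _ => hx i
      _ ≤ b := by simpa using hcard'
  have hq1 : q ≤ 1 := sub_le_self _ (by positivity)
  have cauchy_schwarz : (∑ i, |x i|) ^ 2 ≤ (b : ℝ) ^ 2 * (1 - q) :=
    calc (∑ i, |x i|) ^ 2 ≤ Fintype.card ι * ∑ i, x i ^ 2 := by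
          simpa using sq_sum_le_card_mul_sum_sq (s := Finset.univ) (f := fun i => |x i|)
      _ ≤ b * ∑ i, x i ^ 2 := by gcongr
      _ = (b : ℝ) ^ 2 * (1 - q) := by rw [hq]; field_simp; ring
  have amgm : lam * ∏ i, (1 - x i ^ 2) ≤ lam * q ^ b :=
    mul_le_mul_of_nonneg_left (prod_one_sub_le_pow (by lia) hcard hx) hlam
  have hprod : 0 ≤ lam * ∏ i, (1 - x i ^ 2) :=
    mul_nonneg hlam (Finset.prod_nonneg fun i _ => sub_nonneg.2 (hx i))
  have hmain := sq_mul_le_sq_contractionRate_mul hb hlam hlam' hq0 hq1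
  -- `y / (1 + y)` increases with `y`, so the product may be replaced by its upper bound.
  nlinarith [mul_le_mul_of_nonneg_right cauchy_schwarz hprod, sq_nonneg (contractionRate b lam),
    mul_nonneg hq0 hprod]

/-- The cavity recursion in the coordinate `angle`. -/
noncomputable def angleMap (lam : ℝ) (θ : ι → ℝ) : ℝ :=
  Real.arsinh (√lam * ∏ i, (Real.cosh (θ i))⁻¹)

theorem sq_tanh (x : ℝ) : Real.tanh x ^ 2 = Real.sinh x ^ 2 / (1 + Real.sinh x ^ 2) := by
  rw [Real.tanh_eq_sinh_div_cosh, div_pow, Real.cosh_sq']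

theorem one_sub_sq_tanh (x : ℝ) : 1 - Real.tanh x ^ 2 = (Real.cosh x)⁻¹ ^ 2 := by
  rw [sq_tanh, inv_pow, Real.cosh_sq']
  field_simp
  ring

theorem sq_sinh_angleMap (hlam : 0 ≤ lam) (θ : ι → ℝ) :
    Real.sinh (angleMap lam θ) ^ 2 = lam * ∏ i, (1 - Real.tanh (θ i) ^ 2) := by
  simp only [angleMap, Real.sinh_arsinh, mul_pow, Real.sq_sqrt hlam, one_sub_sq_tanh,
    Finset.prod_pow]

theorem abs_tanh_angleMap_mul_sum_le (hb : 2 ≤ b) (hcard : Fintype.card ι ≤ b) (hlam : 0 ≤ lam)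
    (hlam' : lam < criticalActivity b) (θ : ι → ℝ) :
    |Real.tanh (angleMap lam θ)| * ∑ i, |Real.tanh (θ i)| ≤ contractionRate b lam := by
  refine abs_le_of_sq_le_sq' ?_ (Real.sqrt_nonneg _) |>.2
  have h := sq_sum_abs_mul_le hb hcard hlam hlam' fun i => (Real.tanh_sq_lt_one (θ i)).le
  rw [← sq_sinh_angleMap hlam] at h
  rw [mul_pow, sq_abs, sq_tanh, div_mul_eq_mul_div, div_le_iff₀ (by positivity), mul_comm]
  exact h

theorem hasDerivAt_angleMap_comp {γ : ℝ → ι → ℝ} {γ' : ι → ℝ} {s : ℝ}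
    (hγ : ∀ i, HasDerivAt (fun s => γ s i) (γ' i) s) :
    HasDerivAt (fun s => angleMap lam (γ s))
      (-(Real.tanh (angleMap lam (γ s)) * ∑ i, Real.tanh (γ s i) * γ' i)) s := by
  classical
  have hfactor : ∀ i ∈ Finset.univ, HasDerivAt (fun s => (Real.cosh (γ s i))⁻¹)
      ((Real.cosh (γ s i))⁻¹ * -(Real.tanh (γ s i) * γ' i)) s := fun i _ => by
    refine ((hγ i).cosh.inv (Real.cosh_pos _).ne').congr_deriv ?_
    rw [Real.tanh_eq_sinh_div_cosh]
    field_simp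
  refine ((HasDerivAt.fun_finsetProd hfactor).const_mul √lam).arsinh.congr_deriv ?_
  simp only [smul_eq_mul, ← mul_assoc, Finset.prod_erase_mul _ _ (Finset.mem_univ _),
    ← Finset.mul_sum, Finset.sum_neg_distrib, angleMap, Real.tanh_arsinh]
  ring

theorem abs_angleMap_sub_le (hb : 2 ≤ b) (hcard : Fintype.card ι ≤ b) (hlam : 0 ≤ lam)
    (hlam' : lam < criticalActivity b) (θ θ' : ι → ℝ) {δ : ℝ} (hδ0 : 0 ≤ δ)
    (hδ : ∀ i, |θ i - θ' i| ≤ δ) :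
    |angleMap lam θ - angleMap lam θ'| ≤ contractionRate b lam * δ := by
  let γ : ℝ → ι → ℝ := fun s i => θ' i + s * (θ i - θ' i)
  have hγ (s : ℝ) (i : ι) : HasDerivAt (fun s => γ s i) (θ i - θ' i) s := by
    simpa [γ] using ((hasDerivAt_id s).mul_const (θ i - θ' i)).const_add (θ' i)
  have hbound (s : ℝ) :
      ‖-(Real.tanh (angleMap lam (γ s)) * ∑ i, Real.tanh (γ s i) * (θ i - θ' i))‖
        ≤ contractionRate b lam * δ :=
    calc ‖-(Real.tanh (angleMap lam (γ s)) * ∑ i, Real.tanh (γ s i) * (θ i - θ' i))‖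
        = |Real.tanh (angleMap lam (γ s))| * |∑ i, Real.tanh (γ s i) * (θ i - θ' i)| := by
          rw [norm_neg, Real.norm_eq_abs, abs_mul]
      _ ≤ |Real.tanh (angleMap lam (γ s))| * ∑ i, |Real.tanh (γ s i)| * δ := by
          gcongr
          refine (Finset.abs_sum_le_sum_abs _ _).trans (Finset.sum_le_sum fun i _ => ?_)
          rw [abs_mul]
          gcongr
          exact hδ i
      _ = |Real.tanh (angleMap lam (γ s))| * (∑ i, |Real.tanh (γ s i)|) * δ := by
          rw [← Finset.sum_mul, mul_assoc]
      _ ≤ contractionRate b lam * δ := by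
          gcongr
          exact abs_tanh_angleMap_mul_sum_le hb hcard hlam hlam' (γ s)
  simpa [γ] using norm_image_sub_le_of_norm_deriv_le_segment_01'
    (fun s _ => (hasDerivAt_angleMap_comp (hγ s)).hasDerivWithinAt) (fun s _ => hbound s)

/-- The coordinate on `(0, 1]` in which the cavity recursion contracts; it is defined by
`cosh (angle p) ^ 2 = p⁻¹` and `0 ≤ angle p`. -/
noncomputable def angle (p : ℝ) : ℝ := Real.arsinh √(p⁻¹ - 1)

theorem inv_cosh_angle {p : ℝ} (hp : p ∈ Set.Ioc 0 1) : (Real.cosh (angle p))⁻¹ = √p := by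
  have h : 0 ≤ p⁻¹ - 1 := sub_nonneg.2 ((one_le_inv₀ hp.1).2 hp.2)
  rw [angle, Real.cosh_arsinh, Real.sq_sqrt h, add_sub_cancel, Real.sqrt_inv, inv_inv]

theorem log_eq_neg_two_mul_log_cosh_angle {p : ℝ} (hp : p ∈ Set.Ioc 0 1) :
    Real.log p = -(2 * Real.log (Real.cosh (angle p))) := by
  rw [← mul_neg, ← Real.log_inv, inv_cosh_angle hp, Real.log_sqrt hp.1.le, mul_div_cancel₀]
  exact two_ne_zero

theorem lipschitzWith_log_cosh : LipschitzWith 1 (Real.log ∘ Real.cosh) := by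
  refine lipschitzWith_of_nnnorm_deriv_le
    (Real.differentiable_cosh.log fun x => (Real.cosh_pos x).ne') fun x => ?_
  rw [Real.deriv_log_comp_eq_logDeriv Real.differentiable_cosh.differentiableAt
    (Real.cosh_pos x).ne', Real.logDeriv_cosh]
  simpa [← NNReal.coe_le_coe] using (Real.abs_tanh_lt_one x).le

theorem abs_log_sub_le_two_mul_abs_angle_sub {p q : ℝ} (hp : p ∈ Set.Ioc 0 1)
    (hq : q ∈ Set.Ioc 0 1) : |Real.log p - Real.log q| ≤ 2 * |angle p - angle q| := by
  rw [log_eq_neg_two_mul_log_cosh_angle hp, log_eq_neg_two_mul_log_cosh_angle hq, neg_sub_neg,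
    ← mul_sub, abs_mul, abs_two, abs_sub_comm]
  refine mul_le_mul_of_nonneg_left ?_ zero_le_two
  simpa [Real.dist_eq] using lipschitzWith_log_cosh.dist_le_mul (angle p) (angle q)

theorem abs_angle_sub_le {a p q : ℝ} (ha : 0 < a) (hp : p ∈ Set.Icc a 1) (hq : q ∈ Set.Icc a 1) :
    |angle p - angle q| ≤ angle a := by
  have key {p : ℝ} (hp : p ∈ Set.Icc a 1) : angle p ∈ Set.Icc 0 (angle a) := by
    refine ⟨Real.arsinh_nonneg_iff.2 (Real.sqrt_nonneg _), ?_⟩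
    have := inv_anti₀ ha hp.1
    exact Real.arsinh_le_arsinh.2 (Real.sqrt_le_sqrt (by linarith))
  exact abs_sub_le_of_nonneg_of_le (key hp).1 (key hp).2 (key hq).1 (key hq).2

theorem angle_inv_one_add_mul_prod (hlam : 0 ≤ lam) {p : ι → ℝ} (hp : ∀ i, p i ∈ Set.Ioc 0 1) :
    angle (1 + lam * ∏ i, p i)⁻¹ = angleMap lam fun i => angle (p i) := by
  simp only [angle.eq_1 (1 + _)⁻¹, angleMap, inv_inv, add_sub_cancel_left, Real.sqrt_mul hlam,
    inv_cosh_angle (hp _), Real.sqrt_prod _ fun i _ => (hp i).1.le]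

theorem abs_angle_inv_one_add_mul_prod_sub_le (hb : 2 ≤ b) (hlam : 0 ≤ lam)
    (hlam' : lam < criticalActivity b) {α : Type*} {l : List α} (hl : l.length ≤ b) {p q : α → ℝ}
    (hp : ∀ x ∈ l, p x ∈ Set.Ioc 0 1) (hq : ∀ x ∈ l, q x ∈ Set.Ioc 0 1) {δ : ℝ} (hδ0 : 0 ≤ δ)
    (hδ : ∀ x ∈ l, |angle (p x) - angle (q x)| ≤ δ) :
    |angle (1 + lam * (l.map p).prod)⁻¹ - angle (1 + lam * (l.map q).prod)⁻¹|
      ≤ contractionRate b lam * δ := by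
  have hmem (i : Fin l.length) : l[i.1] ∈ l := List.getElem_mem i.2
  rw [← Fin.prod_univ_fun_getElem, ← Fin.prod_univ_fun_getElem,
    angle_inv_one_add_mul_prod hlam fun i => hp _ (hmem i),
    angle_inv_one_add_mul_prod hlam fun i => hq _ (hmem i)]
  exact abs_angleMap_sub_le hb (by simpa using hl) hlam hlam' _ _ hδ0 fun i => hδ _ (hmem i)

end Contraction

section Recursion

variable {d : ℕ}

/-- The neighbours of a node, in the order in which the algorithm visits them. -/
def neighbors (v : Node d) : List (Node d) := (listNeighbors v).val

theorem length_neighbors (v : Node d) : (neighbors v).length = 2 * d := by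
  simp [neighbors, listNeighbors, mul_comm]

theorem mem_neighbors {v w : Node d} :
    w ∈ neighbors v ↔
      ∃ i, w = Function.update v i (v i - 1) ∨ w = Function.update v i (v i + 1) := by
  simp [neighbors, listNeighbors]

theorem adj_update {v : Node d} {i : Fin d} {x : ℤ} (hx : |v i - x| = 1) :
    (lattice d).Adj v (Function.update v i x) := by
  change ∑ j, |v j - Function.update v i x j| = 1
  rw [Fintype.sum_eq_single i fun j hj => by simp [hj], Function.update_self, hx]

theorem adj_iff_mem_neighbors {v w : Node d} : (lattice d).Adj v w ↔ w ∈ neighbors v := by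
  rw [mem_neighbors]
  constructor
  · intro hvw
    obtain ⟨i, hi⟩ := Function.ne_iff.1 hvw.ne
    have one_le : |v i - w i| ≤ 1 :=
      (Finset.single_le_sum (fun j _ => abs_nonneg (v j - w j)) (Finset.mem_univ i)).trans_eq hvw
    have eq_of_ne (j : Fin d) (hj : j ≠ i) : w j = v j := by
      have := (Finset.add_le_sum (fun j _ => abs_nonneg (v j - w j)) (Finset.mem_univ i)
        (Finset.mem_univ j) hj.symm).trans_eq hvw
      grind
    refine ⟨i, ?_⟩
    rw [Function.eq_update_iff, Function.eq_update_iff]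
    grind
  · rintro ⟨i, rfl | rfl⟩ <;> exact adj_update (by simp)

theorem abs_sub_le_one_of_adj {v w : Node d} (h : (lattice d).Adj v w) (i : Fin d) :
    |v i - w i| ≤ 1 :=
  (Finset.single_le_sum (fun j _ => abs_nonneg (v j - w j)) (Finset.mem_univ i)).trans_eq h

open Classical in
/-- The subproblems of the cavity recursion: each node of the list that lies in the current graph,
paired with the current graph, and then removed from it. -/
noncomputable def children : List (Node d) → Set (Node d) → List (Set (Node d) × Node d)
  | [], _ => []
  | w :: ws, V => if w ∈ V then (V, w) :: children ws (V \ {w}) else children ws V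

theorem mem_children {ws : List (Node d)} {V : Set (Node d)} {c : Set (Node d) × Node d}
    (h : c ∈ children ws V) : c.2 ∈ ws ∧ c.2 ∈ c.1 ∧ c.1 ⊆ V := by
  induction ws generalizing V with
  | nil => simp [children] at h
  | cons w ws ih =>
    rw [children] at h
    split_ifs at h with hw
    · rcases List.mem_cons.1 h with rfl | h
      · exact ⟨List.mem_cons_self, hw, subset_rfl⟩
      · obtain ⟨hws, hc, hV⟩ := ih h
        exact ⟨List.mem_cons_of_mem _ hws, hc, hV.trans Set.sdiff_subset⟩
    · obtain ⟨hws, hc, hV⟩ := ih h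
      exact ⟨List.mem_cons_of_mem _ hws, hc, hV⟩

theorem length_children_le (ws : List (Node d)) (V : Set (Node d)) :
    (children ws V).length ≤ ws.length := by
  induction ws generalizing V with
  | nil => simp [children]
  | cons w ws ih =>
    rw [children]
    split_ifs
    · simpa using ih _
    · exact (ih _).trans (Nat.le_succ _)

theorem length_children_lt {ws : List (Node d)} {V : Set (Node d)} (h : ∃ w ∈ ws, w ∉ V) :
    (children ws V).length < ws.length := by
  induction ws generalizing V with
  | nil => simp at h
  | cons w ws ih =>
    rw [children]
    split_ifs with hw
    · obtain ⟨u, hu, huV⟩ := h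
      have hus : u ∈ ws := (List.mem_cons.1 hu).resolve_left fun huw => huV (huw ▸ hw)
      simpa using ih ⟨u, hus, fun h => huV h.1⟩
    · exact Nat.lt_succ_of_le (length_children_le ws V)

/-- Quantities attached to a node of an induced subgraph of the lattice, like the probability that
the node is vacant in the hard-core model on that subgraph. The cavity recursion acts on them. -/
abbrev Marginal (d : ℕ) : Type := Set (Node d) → Node d → ℝ

/-- One step of the cavity recursion. -/
noncomputable def cavityStep (lam : ℝ) (f : Marginal d) : Marginal d := fun V v =>
  (1 + lam * ((children (neighbors v) (V \ {v})).map fun c => f c.1 c.2).prod)⁻¹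

/-- The range of the cavity recursion on `[0, 1]`-valued quantities. -/
def admissible (d : ℕ) (lam : ℝ) : Set (Marginal d) := Set.Icc (fun _ _ => (1 + lam)⁻¹) 1

variable {lam : ℝ} {f g : Marginal d}

theorem admissible_subset_Icc (hlam : 0 ≤ lam) : admissible d lam ⊆ Set.Icc 0 1 :=
  Set.Icc_subset_Icc_left fun _ _ => by simpa using by positivity

theorem one_mem_admissible (hlam : 0 ≤ lam) : 1 ∈ admissible d lam :=
  ⟨fun _ _ => inv_le_one_of_one_le₀ (by linarith), le_rfl⟩

theorem prod_map_mono (hf : 0 ≤ f) (hfg : f ≤ g) (l : List (Set (Node d) × Node d)) :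
    (l.map fun c => f c.1 c.2).prod ≤ (l.map fun c => g c.1 c.2).prod :=
  List.prod_map_le_prod_map₀ _ _ (fun c _ => hf c.1 c.2) fun c _ => hfg c.1 c.2

theorem prod_map_mem_Icc (hf : f ∈ Set.Icc 0 1) (l : List (Set (Node d) × Node d)) :
    (l.map fun c => f c.1 c.2).prod ∈ Set.Icc 0 1 :=
  ⟨List.prod_nonneg (List.forall_mem_map.2 fun c _ => hf.1 c.1 c.2),
    by simpa using prod_map_mono hf.1 hf.2 l⟩

theorem mapsTo_cavityStep (hlam : 0 ≤ lam) :
    Set.MapsTo (cavityStep lam) (Set.Icc 0 1) (admissible d lam) := by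
  intro f hf
  refine ⟨fun V v => ?_, fun V v => ?_⟩
  all_goals
    obtain ⟨prod_nonneg, prod_le_one⟩ := prod_map_mem_Icc hf (children (neighbors v) (V \ {v}))
  · exact inv_anti₀ (by positivity) (by gcongr; exact mul_le_of_le_one_right hlam prod_le_one)
  · exact inv_le_one_of_one_le₀ (by linarith [mul_nonneg hlam prod_nonneg])

theorem mapsTo_iterate_admissible (hlam : 0 ≤ lam) (t : ℕ) :
    Set.MapsTo (cavityStep lam)^[t] (admissible d lam) (admissible d lam) :=
  ((mapsTo_cavityStep hlam).mono_left (admissible_subset_Icc hlam)).iterate t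

theorem mapsTo_iterate_Icc (hlam : 0 ≤ lam) (t : ℕ) :
    Set.MapsTo (cavityStep lam)^[t] (Set.Icc (0 : Marginal d) 1) (Set.Icc 0 1) :=
  ((mapsTo_cavityStep hlam).mono_right (admissible_subset_Icc hlam)).iterate t

theorem antitoneOn_cavityStep (hlam : 0 ≤ lam) :
    AntitoneOn (cavityStep lam) (Set.Icc (0 : Marginal d) 1) := by
  intro f hf g _ hfg V v
  have prod_nonneg := (prod_map_mem_Icc hf (children (neighbors v) (V \ {v}))).1
  have prod_le := prod_map_mono hf.1 hfg (children (neighbors v) (V \ {v}))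
  exact inv_anti₀ (by positivity) (by gcongr)

theorem monotoneOn_iterate_two_mul (hlam : 0 ≤ lam) (t : ℕ) :
    MonotoneOn (cavityStep lam)^[2 * t] (Set.Icc (0 : Marginal d) 1) := by
  induction t with
  | zero => exact monotoneOn_id
  | succ t ih =>
    have hanti := antitoneOn_cavityStep (d := d) hlam
    have htwice := hanti.comp hanti (mapsTo_iterate_Icc hlam 1)
    exact ih.comp htwice (mapsTo_iterate_Icc hlam 2)

/-- A node is exposed in the graph on `V` if one of its lattice neighbours is missing. At such a
node the recursion has at most `2 d - 1` children, and the children are exposed too. -/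
def Exposed (V : Set (Node d)) (v : Node d) : Prop := ∃ w, (lattice d).Adj v w ∧ w ∉ V

theorem Exposed.mono {V W : Set (Node d)} {v : Node d} (hV : Exposed V v) (hWV : W ⊆ V) :
    Exposed W v :=
  let ⟨w, hvw, hw⟩ := hV
  ⟨w, hvw, fun h => hw (hWV h)⟩

theorem Exposed.length_children_lt {V : Set (Node d)} {v : Node d} (hv : Exposed V v) :
    (children (neighbors v) (V \ {v})).length < 2 * d := by
  obtain ⟨w, hvw, hw⟩ := hv.mono (Set.sdiff_subset (t := {v}))
  rw [← length_neighbors v]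
  exact HardCore.length_children_lt ⟨w, adj_iff_mem_neighbors.1 hvw, hw⟩

theorem exposed_of_mem_children {V : Set (Node d)} {v : Node d} {c : Set (Node d) × Node d}
    (hc : c ∈ children (neighbors v) (V \ {v})) : Exposed c.1 c.2 :=
  let ⟨hadj, _, hsub⟩ := mem_children hc
  ⟨v, (adj_iff_mem_neighbors.2 hadj).symm, fun h => (hsub h).2 rfl⟩

theorem abs_angle_iterate_sub_le (hd : 2 ≤ d) (hlam : 0 ≤ lam)
    (hlam' : lam < criticalActivity (2 * d - 1)) (hf : f ∈ admissible d lam)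
    (hg : g ∈ admissible d lam) (t : ℕ) {V : Set (Node d)} {v : Node d} (hv : Exposed V v) :
    |angle ((cavityStep lam)^[t] f V v) - angle ((cavityStep lam)^[t] g V v)|
      ≤ contractionRate (2 * d - 1) lam ^ t * angle (1 + lam)⁻¹ := by
  have hpos : 0 < (1 + lam)⁻¹ := by positivity
  have mem_Icc {f : Marginal d} (hf : f ∈ admissible d lam) (t : ℕ) (V v) :
      (cavityStep lam)^[t] f V v ∈ Set.Icc (1 + lam)⁻¹ 1 :=
    have h := mapsTo_iterate_admissible hlam t hf
    ⟨h.1 V v, h.2 V v⟩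
  have mem_Ioc {f : Marginal d} (hf : f ∈ admissible d lam) (t : ℕ) (V v) :
      (cavityStep lam)^[t] f V v ∈ Set.Ioc 0 1 :=
    ⟨hpos.trans_le (mem_Icc hf t V v).1, (mem_Icc hf t V v).2⟩
  induction t generalizing V v with
  | zero => simpa using abs_angle_sub_le hpos (mem_Icc hf 0 V v) (mem_Icc hg 0 V v)
  | succ t ih =>
    rw [Function.iterate_succ_apply', Function.iterate_succ_apply', pow_succ', mul_assoc]
    have hlen := hv.length_children_lt
    exact abs_angle_inv_one_add_mul_prod_sub_le (by lia) hlam hlam' (by lia)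
      (fun c _ => mem_Ioc hf t c.1 c.2) (fun c _ => mem_Ioc hg t c.1 c.2)
      ((abs_nonneg _).trans (ih hv)) fun c hc => ih (exposed_of_mem_children hc)

/-- Decay of correlations (strong spatial mixing): at exposed nodes, the cavity recursion forgets
its initial values at the rate `C * κ ^ t`. -/
structure SpatialMixing (d : ℕ) (lam C κ : ℝ) : Prop where
  activity_nonneg : 0 ≤ lam
  rate_nonneg : 0 ≤ κ
  rate_lt_one : κ < 1
  abs_log_iterate_sub_le {f g : Marginal d} (hf : f ∈ admissible d lam)
    (hg : g ∈ admissible d lam) (t : ℕ) {V : Set (Node d)} {v : Node d} (hv : Exposed V v) :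
    |Real.log ((cavityStep lam)^[t] f V v) - Real.log ((cavityStep lam)^[t] g V v)| ≤ C * κ ^ t

theorem spatialMixing_of_lt_criticalActivity (hd : 2 ≤ d) (hlam : 0 ≤ lam)
    (hlam' : lam < criticalActivity (2 * d - 1)) :
    SpatialMixing d lam (2 * angle (1 + lam)⁻¹) (contractionRate (2 * d - 1) lam) where
  activity_nonneg := hlam
  rate_nonneg := Real.sqrt_nonneg _
  rate_lt_one := contractionRate_lt_one hlam hlam'
  abs_log_iterate_sub_le {f g} hf hg t {V v} hv := by
    have hpos : 0 < (1 + lam)⁻¹ := by positivity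
    have mem_Ioc {f : Marginal d} (hf : f ∈ admissible d lam) :
        (cavityStep lam)^[t] f V v ∈ Set.Ioc 0 1 :=
      have h := mapsTo_iterate_admissible hlam t hf
      ⟨hpos.trans_le (h.1 V v), h.2 V v⟩
    calc _ ≤ 2 * |angle ((cavityStep lam)^[t] f V v) - angle ((cavityStep lam)^[t] g V v)| :=
          abs_log_sub_le_two_mul_abs_angle_sub (mem_Ioc hf) (mem_Ioc hg)
      _ ≤ 2 * angle (1 + lam)⁻¹ * contractionRate (2 * d - 1) lam ^ t := by
          linarith [abs_angle_iterate_sub_le hd hlam hlam' hf hg t hv]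

theorem criticalActivity_two_mul_sub_one (hd : 1 ≤ d) :
    criticalActivity (2 * d - 1) = (2 * d - 1 : ℝ) ^ (2 * d - 1) / (2 * d - 2 : ℝ) ^ (2 * d) := by
  rw [criticalActivity, Nat.sub_add_cancel (by lia), Nat.cast_sub (by lia)]
  push_cast
  ring_nf

/-- The graph `V` seen from `v` and the graph `V'` seen from `v'` agree up to sup-distance `t`. -/
def AgreeNear (t : ℕ) (V : Set (Node d)) (v : Node d) (V' : Set (Node d)) (v' : Node d) : Prop :=
  ∀ u : Node d, (∀ i, |u i| ≤ t) → (v + u ∈ V ↔ v' + u ∈ V')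

theorem neighbors_eq_map_add (v : Node d) : neighbors v = (neighbors 0).map (v + ·) := by
  simp only [neighbors, listNeighbors, List.map_flatMap, List.map_cons, List.map_nil]
  congr! with i <;>
  · funext j
    rcases eq_or_ne j i with rfl | hj
    · simp [sub_eq_add_neg]
    · simp [hj]

theorem AgreeNear.prod_children_eq {t : ℕ}
    (hf : ∀ {V v V' v'}, AgreeNear t V v V' v' → f V v = f V' v') (v v' : Node d)
    {us : List (Node d)} (hus : ∀ u ∈ us, ∀ i, |u i| ≤ 1) {V V' : Set (Node d)}
    (h : AgreeNear (t + 1) V v V' v') :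
    ((children (us.map (v + ·)) V).map fun c => f c.1 c.2).prod
      = ((children (us.map (v' + ·)) V').map fun c => f c.1 c.2).prod := by
  induction us generalizing V V' with
  | nil => simp [children]
  | cons u us ih =>
    obtain ⟨hu, hus⟩ := List.forall_mem_cons.1 hus
    have mem_iff : v + u ∈ V ↔ v' + u ∈ V' := h u fun i => (hu i).trans (by push_cast; lia)
    simp only [List.map_cons, children]
    split_ifs with hV hV' hV'
    · simp only [List.map_cons, List.prod_cons]
      congr 1
      · refine hf fun w hw => ?_
        rw [add_assoc, add_assoc]
        refine h _ fun i => (abs_add_le (u i) (w i)).trans ?_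
        push_cast
        linarith [hu i, hw i]
      · refine ih hus fun w hw => ?_
        simp only [Set.mem_sdiff, Set.mem_singleton_iff, add_right_inj, h w hw]
    · exact absurd (mem_iff.1 hV) hV'
    · exact absurd (mem_iff.2 hV') hV
    · exact ih hus h

theorem AgreeNear.cavityStep_eq {t : ℕ}
    (hf : ∀ {V v V' v'}, AgreeNear t V v V' v' → f V v = f V' v') {V V' : Set (Node d)}
    {v v' : Node d} (h : AgreeNear (t + 1) V v V' v') :
    cavityStep lam f V v = cavityStep lam f V' v' := by
  have hsdiff : AgreeNear (t + 1) (V \ {v}) v (V' \ {v'}) v' := fun u hu => by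
    simp only [Set.mem_sdiff, Set.mem_singleton_iff, add_eq_left, h u hu]
  unfold cavityStep
  rw [neighbors_eq_map_add v, neighbors_eq_map_add v', hsdiff.prod_children_eq hf]
  intro u hu i
  simpa using abs_sub_le_one_of_adj (adj_iff_mem_neighbors.2 hu) i

theorem AgreeNear.iterate_const_eq (x : ℝ) {t : ℕ} {V V' : Set (Node d)} {v v' : Node d}
    (h : AgreeNear t V v V' v') :
    (cavityStep lam)^[t] (fun _ _ => x) V v = (cavityStep lam)^[t] (fun _ _ => x) V' v' := by
  induction t generalizing V v V' v' with
  | zero => rfl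
  | succ t ih =>
    rw [Function.iterate_succ_apply']
    exact h.cavityStep_eq ih

end Recursion

section Algorithm

namespace Timed

variable {α β ι : Type}

@[simp] theorem bind_val (x : Timed α) (f : α → Timed β) : (x >>= f).val = (f x.val).val := rfl

@[simp] theorem bind_cost (x : Timed α) (f : α → Timed β) :
    (x >>= f).cost = x.cost + (f x.val).cost := rfl

@[simp] theorem pure_val (x : α) : (pure x : Timed α).val = x := rfl

@[simp] theorem pure_cost (x : α) : (pure x : Timed α).cost = 0 := rfl

theorem sum_val (f : ι → Timed ℝ) (l : List ι) :
    (Timed.sum f l).val = (l.map fun i => (f i).val).sum := by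
  induction l with
  | nil => simp [Timed.sum]
  | cons i l ih => simp [Timed.sum, Timed.add, ih]

theorem prod_val (f : ι → Timed ℝ) (l : List ι) :
    (Timed.prod f l).val = (l.map fun i => (f i).val).prod := by
  induction l with
  | nil => simp [Timed.prod]
  | cons i l ih => simp [Timed.prod, Timed.mul, ih]

theorem sum_cost_le {f : ι → Timed ℝ} {B : ℕ} (hf : ∀ i, (f i).cost ≤ B) (l : List ι) :
    (Timed.sum f l).cost ≤ 1 + l.length * (B + 2) := by
  induction l with
  | nil => simp [Timed.sum, spend]
  | cons i l ih =>
    simp only [Timed.sum, bind_cost, spend, add, List.length_cons]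
    linarith [hf i]

theorem prod_cost_le {f : ι → Timed ℝ} {B : ℕ} (hf : ∀ i, (f i).cost ≤ B) (l : List ι) :
    (Timed.prod f l).cost ≤ 1 + l.length * (B + 2) := by
  induction l with
  | nil => simp [Timed.prod, spend]
  | cons i l ih =>
    simp only [Timed.prod, bind_cost, spend, mul, List.length_cons]
    linarith [hf i]

end Timed

variable {d : ℕ}

theorem testMem_val (w : Node d) (l : List (Node d)) : (testMem w l).val = decide (w ∈ l) := by
  induction l with
  | nil => simp [testMem]
  | cons u l ih =>
    simp only [testMem, Timed.bind_val]
    split_ifs with h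
    · simp [h]
    · simp [ih, Ne.symm h]

theorem testMem_cost_le (w : Node d) (l : List (Node d)) :
    (testMem w l).cost ≤ (d + 1) * l.length + 1 := by
  induction l with
  | nil => simp [testMem, Timed.spend]
  | cons u l ih =>
    simp only [testMem, Timed.bind_cost, Timed.spend, List.length_cons]
    split_ifs
    · simp only [Timed.pure_cost]
      nlinarith
    · linarith

theorem sdiff_setOf_mem_cons {α : Type*} (s : Set α) (a : α) (l : List α) :
    s \ {u | u ∈ a :: l} = (s \ {u | u ∈ l}) \ {a} := by
  ext u
  simp only [Set.mem_sdiff, Set.mem_ofPred_eq, List.mem_cons, Set.mem_singleton_iff]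
  tauto

theorem childProduct_val {D : Domain d} {child : List (Node d) → Node d → Timed ℝ}
    {f : Marginal d}
    (hf : ∀ removed v, (child removed v).val = f (D.cavityNodes \ {u | u ∈ removed}) v)
    (ws removed : List (Node d)) :
    (childProduct D child ws removed).val
      = ((children ws (D.cavityNodes \ {u | u ∈ removed})).map fun c => f c.1 c.2).prod := by
  induction ws generalizing removed with
  | nil => simp [childProduct, children]
  | cons w ws ih =>
    simp only [childProduct, children, Timed.bind_val, testMem_val, testRegion]
    by_cases hw : w ∈ D.cavityNodes \ {u | u ∈ removed}
    · rw [if_pos (by simpa using hw), if_pos hw]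
      simp only [Timed.bind_val, Timed.mul, hf, ih, List.map_cons, List.prod_cons,
        sdiff_setOf_mem_cons]
    · rw [if_neg (by simpa using hw), if_neg hw, ih]

theorem cavity_val (D : Domain d) (lam x : ℝ) (t : ℕ) (removed : List (Node d)) (v : Node d) :
    (cavity D lam x t removed v).val
      = (cavityStep lam)^[t] (fun _ _ => x) (D.cavityNodes \ {u | u ∈ removed}) v := by
  induction t generalizing removed v with
  | zero => simp [cavity]
  | succ t ih =>
    rw [Function.iterate_succ_apply', cavityStep, ← one_div, ← sdiff_setOf_mem_cons,
      ← childProduct_val ih]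
    rfl

theorem logCavity_val (D : Domain d) (lam x : ℝ) (t : ℕ) :
    (logCavity D lam x t).val
      = Real.log ((cavityStep lam)^[t] (fun _ _ => x) D.cavityNodes 0) := by
  simp [logCavity, Timed.log, cavity_val]

theorem childProduct_cost_le (D : Domain d) {child : List (Node d) → Node d → Timed ℝ}
    {n B : ℕ} (hB : ∀ removed v, removed.length ≤ n → (child removed v).cost ≤ B)
    {ws removed : List (Node d)} (h : removed.length + ws.length ≤ n) :
    (childProduct D child ws removed).cost
      ≤ 1 + ws.length * (2 * d + 5 + (d + 1) * n + B) := by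
  induction ws generalizing removed with
  | nil => simp [childProduct, Timed.spend]
  | cons w ws ih =>
    rw [List.length_cons] at h
    have htest : (testMem w removed).cost ≤ (d + 1) * n + 1 :=
      (testMem_cost_le w removed).trans (by gcongr; lia)
    simp only [childProduct, Timed.bind_cost, Timed.spend, testRegion, List.length_cons]
    rw [add_mul, one_mul]
    split_ifs
    · have hchild := hB removed w (by lia)
      have hrest := ih (removed := w :: removed) (by rw [List.length_cons]; lia)
      simp only [Timed.bind_cost, Timed.mul]
      lia
    · have hrest := ih (removed := removed) (by lia)
      lia

/-- The growth rate of the running time of the cavity recursion in its depth. -/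
def costRate (d : ℕ) : ℕ := 16 * (d + 1) ^ 3

theorem cavity_cost_le (D : Domain d) (lam x : ℝ) (t : ℕ) (removed : List (Node d))
    (v : Node d) :
    (cavity D lam x t removed v).cost ≤ costRate d ^ (t + 1) * (removed.length + 1) := by
  have hK : 0 < costRate d := by unfold costRate; positivity
  induction t generalizing removed v with
  | zero => exact Nat.mul_le_mul (Nat.one_le_pow _ _ hK) (Nat.le_add_left 1 _)
  | succ t ih =>
    set n := removed.length + 1 + 2 * d
    set Y := costRate d ^ (t + 1) * (removed.length + 1)
    have hY : 1 ≤ Y := Nat.succ_le_of_lt (by positivity)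
    have hchild (r : List (Node d)) (w : Node d) (hr : r.length ≤ n) :
        (cavity D lam x t r w).cost ≤ (2 * d + 2) * Y :=
      calc _ ≤ costRate d ^ (t + 1) * (r.length + 1) := ih r w
        _ ≤ costRate d ^ (t + 1) * ((2 * d + 2) * (removed.length + 1)) := by gcongr; lia
        _ = (2 * d + 2) * Y := by ring
    have hnY : n ≤ (2 * d + 2) * Y :=
      calc n ≤ (2 * d + 2) * (removed.length + 1) := by lia
        _ ≤ (2 * d + 2) * Y := by gcongr; exact Nat.le_mul_of_pos_left _ (by positivity)
    have hprod := childProduct_cost_le D hchild (ws := neighbors v) (removed := v :: removed)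
      (by rw [length_neighbors, List.length_cons])
    rw [length_neighbors] at hprod
    calc (cavity D lam x (t + 1) removed v).cost
        = 1 + ((2 * d * (d + 2) + 1)
          + ((childProduct D (cavity D lam x t) (neighbors v) (v :: removed)).cost + 3)) := rfl
      _ ≤ 1 + ((2 * d * (d + 2) + 1)
          + (1 + 2 * d * (2 * d + 5 + (d + 1) * ((2 * d + 2) * Y) + (2 * d + 2) * Y) + 3)) := by
          gcongr
          exact hprod.trans (by gcongr)
      _ = (6 * d ^ 2 + 14 * d + 6) + (4 * d ^ 3 + 12 * d ^ 2 + 8 * d) * Y := by ring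
      _ ≤ (6 * d ^ 2 + 14 * d + 6) * Y + (4 * d ^ 3 + 12 * d ^ 2 + 8 * d) * Y := by
          gcongr
          exact Nat.le_mul_of_pos_right _ hY
      _ ≤ costRate d * Y := by
          rw [← add_mul, costRate]
          gcongr
          lia
      _ = costRate d ^ (t + 1 + 1) * (removed.length + 1) := by ring

theorem logCavity_cost_le (D : Domain d) (lam x : ℝ) (t : ℕ) :
    (logCavity D lam x t).cost ≤ costRate d ^ (t + 1) + 1 := by
  simpa [logCavity, Timed.log] using cavity_cost_le D lam x t [] 0

theorem computeFaceArea_val (a : Fin d → ℝ) (j : Fin d) :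
    (computeFaceArea a j).val = faceArea a j := by
  rw [computeFaceArea, Timed.prod_val, ← Fin.prod_univ_def, faceArea,
    ← Finset.mul_prod_erase Finset.univ _ (Finset.mem_univ j)]
  simp only [Timed.bind_val, if_true, Timed.pure_val, one_mul]
  refine Finset.prod_congr rfl fun k hk => ?_
  rw [if_neg (Finset.ne_of_mem_erase hk)]
  rfl

theorem computeFaceArea_cost_le (a : Fin d → ℝ) (j : Fin d) :
    (computeFaceArea a j).cost ≤ 1 + d * 4 := by
  rw [computeFaceArea]
  convert Timed.prod_cost_le (B := 2) (fun k => ?_) (List.finRange d)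
  · simp
  · split_ifs <;> simp [Timed.spend, Timed.mul]

/-- The number of halvings after which the algorithm reaches the accuracy `ε`. -/
noncomputable def halvings (ε : ℝ) : ℕ := sInf {m : ℕ | (1 / 2 : ℝ) ^ m ≤ ε}

theorem level_val (c : ℕ) (ε : ℝ) : (level c ε).val = c * (halvings ε + 1) := rfl

theorem level_cost (c : ℕ) (ε : ℝ) : (level c ε).cost = 3 * (halvings ε + 1) := rfl

theorem half_pow_halvings_le {ε : ℝ} (hε : 0 < ε) : (1 / 2 : ℝ) ^ halvings ε ≤ ε := by
  obtain ⟨m, hm⟩ := exists_pow_lt_of_lt_one hε (by norm_num : (1 / 2 : ℝ) < 1)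
  exact Nat.sInf_mem (s := {m : ℕ | (1 / 2 : ℝ) ^ m ≤ ε}) ⟨m, hm.le⟩

theorem two_pow_halvings_succ_le {ε : ℝ} (hε : 0 < ε) :
    (2 : ℝ) ^ (halvings ε + 1) ≤ (max 2 (1 / ε)) ^ 3 := by
  set M := max 2 (1 / ε)
  have hM : 2 ≤ M := le_max_left _ _
  cases hm : halvings ε with
  | zero => simpa using hM.trans (le_self_pow₀ (by linarith) three_ne_zero)
  | succ k =>
    have hk : ε < (1 / 2 : ℝ) ^ k := not_le.1 fun h => by
      have : halvings ε ≤ k := Nat.sInf_le h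
      lia
    have two_pow_le : (2 : ℝ) ^ k ≤ M := by
      rw [one_div, inv_pow, lt_inv_comm₀ hε (by positivity), ← one_div] at hk
      exact hk.le.trans (le_max_right _ _)
    calc (2 : ℝ) ^ (k + 1 + 1) = 2 ^ k * 2 ^ 2 := by ring
      _ ≤ M * M ^ 2 := by gcongr
      _ = M ^ 3 := by ring

variable (d) (lam : ℝ) (c : ℕ) (ε : ℝ)

theorem scaFreeEnergy_cost_le :
    (scaFreeEnergy d lam c ε).cost
      ≤ (level c ε).cost + 7 * costRate d ^ (2 * (level c ε).val + 1) := by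
  have hX : 0 < costRate d ^ (2 * (level c ε).val + 1) := by unfold costRate; positivity
  have upper_cost := logCavity_cost_le (.whole : Domain d) lam 1 (2 * (level c ε).val)
  have lower_cost := logCavity_cost_le (.whole : Domain d) lam 0 (2 * (level c ε).val)
  simp only [scaFreeEnergy, Timed.bind_cost, Timed.spend, Timed.sub, Timed.pure_cost]
  lia

theorem scaSurfacePressure_cost_le (a : Fin d → ℝ) :
    (scaSurfacePressure d lam a c ε).cost ≤ (level c ε).cost
      + 9 * (d + 1) ^ 2 * ((level c ε).val + 1) * costRate d ^ (2 * (level c ε).val + 1) := by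
  simp only [scaSurfacePressure, Timed.bind_cost, Timed.spend]
  set t := (level c ε).val
  set X := costRate d ^ (2 * t + 1)
  have hX : 1 ≤ X := Nat.succ_le_of_lt (by unfold X costRate; positivity)
  have log_cost (D : Domain d) : (logCavity D lam 1 (2 * t)).cost ≤ X + 1 :=
    logCavity_cost_le D lam 1 (2 * t)
  calc _ ≤ (level c ε).cost + (1 + ((X + 1) + ((1 + d * (1 + d * 4 + 2))
        + (1 + d * (1 + d * 4 + (1 + (1 + t * (2 * X + 5 + 2) + 1)) + 2))))) := by
        gcongr
        · exact log_cost _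
        · simpa using Timed.sum_cost_le (computeFaceArea_cost_le a) (List.finRange d)
        · refine (Timed.sum_cost_le (B := 1 + d * 4 + (1 + (1 + t * (2 * X + 5 + 2) + 1)))
            (fun j => ?_) _).trans (by rw [List.length_finRange])
          simp only [Timed.bind_cost, Timed.div, Timed.mul]
          gcongr
          · exact computeFaceArea_cost_le a j
          · refine (Timed.sum_cost_le (B := 2 * X + 5) (fun k => ?_) _).trans
              (by rw [List.length_range])
            simp only [Timed.bind_cost, Timed.sub]
            linarith [log_cost (.upper j k), log_cost (.lower j k)]
    _ = (level c ε).cost + ((4 + 9 * d + 8 * d ^ 2 + 7 * d * t) * 1 + (1 + 2 * d * t) * X) := by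
        ring
    _ ≤ (level c ε).cost
        + ((4 + 9 * d + 8 * d ^ 2 + 7 * d * t) * X + (1 + 2 * d * t) * X) := by gcongr
    _ ≤ (level c ε).cost + 9 * (d + 1) ^ 2 * (t + 1) * X := by
        rw [← add_mul]
        gcongr
        nlinarith [Nat.zero_le (d * t), Nat.zero_le (d ^ 2 * t)]

variable {d c ε}

theorem level_cost_add_le_pow (hc : 0 < c) :
    (level c ε).cost
        + 9 * (d + 1) ^ 2 * ((level c ε).val + 1) * costRate d ^ (2 * (level c ε).val + 1)
      ≤ costRate d ^ (3 * (level c ε).val + 2) := by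
  have hm : halvings ε + 1 ≤ (level c ε).val := Nat.le_mul_of_pos_left _ hc
  rw [level_cost]
  set t := (level c ε).val
  have hK : 16 * (d + 1) ^ 2 ≤ costRate d := by
    unfold costRate
    gcongr <;> lia
  have hd : 0 < (d + 1) ^ 2 := by positivity
  have hK1 : 1 < costRate d := by lia
  have level_le : halvings ε + 1 ≤ (d + 1) ^ 2 * (t + 1) * costRate d ^ (2 * t + 1) :=
    calc halvings ε + 1 ≤ t + 1 := hm.trans (Nat.le_succ t)
      _ ≤ (d + 1) ^ 2 * (t + 1) := Nat.le_mul_of_pos_left _ hd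
      _ ≤ (d + 1) ^ 2 * (t + 1) * costRate d ^ (2 * t + 1) :=
        Nat.le_mul_of_pos_right _ (by positivity)
  calc 3 * (halvings ε + 1) + 9 * (d + 1) ^ 2 * (t + 1) * costRate d ^ (2 * t + 1)
      ≤ 3 * ((d + 1) ^ 2 * (t + 1) * costRate d ^ (2 * t + 1))
        + 9 * (d + 1) ^ 2 * (t + 1) * costRate d ^ (2 * t + 1) := by gcongr
    _ = 12 * (d + 1) ^ 2 * (t + 1) * costRate d ^ (2 * t + 1) := by ring
    _ ≤ costRate d * costRate d ^ t * costRate d ^ (2 * t + 1) := by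
        gcongr
        · lia
        · exact Nat.succ_le_of_lt (Nat.lt_pow_self hK1)
    _ = costRate d ^ (3 * t + 2) := by ring

theorem costRate_pow_le (hε : 0 < ε) :
    ((costRate d ^ (3 * (level c ε).val + 2) : ℕ) : ℝ)
      ≤ max 2 (1 / ε) ^ (3 * (costRate d * (3 * c + 2))) := by
  have hK : 0 < costRate d := by unfold costRate; positivity
  calc ((costRate d ^ (3 * (level c ε).val + 2) : ℕ) : ℝ)
      ≤ (costRate d : ℝ) ^ ((3 * c + 2) * (halvings ε + 1)) := by
        push_cast
        gcongr
        · exact_mod_cast hK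
        · rw [level_val]
          lia
    _ ≤ (2 ^ costRate d) ^ ((3 * c + 2) * (halvings ε + 1)) := by
        gcongr
        exact_mod_cast Nat.lt_two_pow_self.le
    _ = (2 ^ (halvings ε + 1)) ^ (costRate d * (3 * c + 2)) := by
        simp only [← pow_mul]
        congr 1
        ring
    _ ≤ (max 2 (1 / ε) ^ 3) ^ (costRate d * (3 * c + 2)) := by
        gcongr
        exact two_pow_halvings_succ_le hε
    _ = max 2 (1 / ε) ^ (3 * (costRate d * (3 * c + 2))) := (pow_mul _ _ _).symm

theorem scaFreeEnergy_cost_le_pow (hc : 0 < c) (hε : 0 < ε) :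
    ((scaFreeEnergy d lam c ε).cost : ℝ) ≤ max 2 (1 / ε) ^ (3 * (costRate d * (3 * c + 2))) := by
  refine le_trans (Nat.cast_le.2 ?_) (costRate_pow_le hε)
  refine ((scaFreeEnergy_cost_le d lam c ε).trans ?_).trans (level_cost_add_le_pow hc)
  have : 0 < (d + 1) ^ 2 * ((level c ε).val + 1) := by positivity
  gcongr
  lia

theorem scaSurfacePressure_cost_le_pow (hc : 0 < c) (hε : 0 < ε) (a : Fin d → ℝ) :
    ((scaSurfacePressure d lam a c ε).cost : ℝ)
      ≤ max 2 (1 / ε) ^ (3 * (costRate d * (3 * c + 2))) :=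
  (Nat.cast_le.2 ((scaSurfacePressure_cost_le d lam c ε a).trans
    (level_cost_add_le_pow hc))).trans (costRate_pow_le hε)

end Algorithm

section PartitionFunction

theorem isIndepSet_insert {α : Type*} {G : SimpleGraph α} {s : Set α} {a : α} :
    G.IsIndepSet (insert a s) ↔ G.IsIndepSet s ∧ ∀ b ∈ s, ¬ G.Adj a b := by
  simp only [SimpleGraph.IsIndepSet, Set.pairwise_insert, G.adj_comm _ a, and_self]
  exact and_congr_right fun _ => forall₂_congr fun b _ =>
    ⟨fun h hab => h hab.ne hab, fun h _ => h⟩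

variable {d : ℕ} {lam : ℝ}

open Classical in
theorem partitionFunction_insert (lam : ℝ) {v : Node d} {Λ : Finset (Node d)} (hv : v ∉ Λ) :
    partitionFunction d lam (insert v Λ) = partitionFunction d lam Λ
      + lam * partitionFunction d lam (Λ.filter fun u => ¬ (lattice d).Adj v u) := by
  unfold partitionFunction
  rw [Finset.sum_filter, Finset.sum_powerset_insert hv, ← Finset.sum_filter, ← Finset.sum_filter,
    Finset.mul_sum]
  congr 1
  refine Finset.sum_congr ?_ fun I hI => ?_
  · ext I
    simp only [Finset.mem_filter, Finset.mem_powerset, Finset.coe_insert, isIndepSet_insert,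
      Finset.subset_iff, forall₂_and, Finset.mem_coe]
    tauto
  · have hvI : v ∉ I := fun h => hv (Finset.filter_subset _ _
      (Finset.mem_powerset.1 (Finset.mem_filter.1 hI).1 h))
    rw [Finset.card_insert_of_notMem hvI, pow_succ']

theorem partitionFunction_pos (hlam : 0 ≤ lam) (Λ : Finset (Node d)) :
    0 < partitionFunction d lam Λ :=
  Finset.sum_pos' (fun I _ => pow_nonneg hlam _) ⟨∅, by simp [SimpleGraph.IsIndepSet], by simp⟩

theorem partitionFunction_empty : partitionFunction d lam ∅ = 1 := by
  simp [partitionFunction, Finset.filter_singleton, SimpleGraph.IsIndepSet]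

open Classical in
/-- The partition function as a function of a set of nodes, which the cavity recursion needs; its
value is `1` at infinite sets. -/
noncomputable def setPartition (lam : ℝ) (V : Set (Node d)) : ℝ :=
  if h : V.Finite then partitionFunction d lam h.toFinset else 1

theorem setPartition_coe (lam : ℝ) (Λ : Finset (Node d)) :
    setPartition lam (Λ : Set (Node d)) = partitionFunction d lam Λ := by
  rw [setPartition, dif_pos Λ.finite_toSet, Finset.finite_toSet_toFinset]

theorem setPartition_pos (hlam : 0 ≤ lam) (V : Set (Node d)) : 0 < setPartition lam V := by
  unfold setPartition
  split_ifs
  · exact partitionFunction_pos hlam _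
  · exact one_pos

theorem setPartition_eq_add (lam : ℝ) {V : Set (Node d)} (hV : V.Finite) {v : Node d}
    (hv : v ∈ V) :
    setPartition lam V = setPartition lam (V \ {v})
      + lam * setPartition lam ((V \ {v}) \ {u | u ∈ neighbors v}) := by
  classical
  obtain ⟨Λ, rfl⟩ := hV.exists_finset_coe
  have coe_filter : (↑(Λ.erase v) : Set (Node d)) \ {u | u ∈ neighbors v}
      = ↑((Λ.erase v).filter fun u => ¬ (lattice d).Adj v u) := by
    ext u
    simp only [adj_iff_mem_neighbors, Finset.coe_filter]
    rfl
  rw [← Finset.coe_erase, coe_filter, setPartition_coe, setPartition_coe, setPartition_coe,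
    ← partitionFunction_insert lam (Finset.notMem_erase v Λ),
    Finset.insert_erase (Finset.mem_coe.1 hv)]

theorem setPartition_sdiff_singleton_le (hlam : 0 ≤ lam) (V : Set (Node d)) (v : Node d) :
    setPartition lam (V \ {v}) ≤ setPartition lam V := by
  by_cases hv : v ∈ V
  · by_cases hV : V.Finite
    · rw [setPartition_eq_add lam hV hv]
      exact le_add_of_nonneg_right (mul_nonneg hlam (setPartition_pos hlam _).le)
    · have hV' : ¬ (V \ {v}).Finite := fun h => hV (h.of_sdiff (Set.finite_singleton v))
      rw [setPartition, setPartition, dif_neg hV, dif_neg hV']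
  · rw [Set.sdiff_singleton_eq_self hv]

/-- The probability that the node `v` is not occupied, in the hard-core model on the finite set
`V`. -/
noncomputable def vacancy (lam : ℝ) : Marginal d := fun V v =>
  setPartition lam (V \ {v}) / setPartition lam V

theorem prod_children_vacancy (hlam : 0 ≤ lam) (ws : List (Node d)) (V : Set (Node d)) :
    ((children ws V).map fun c => vacancy lam c.1 c.2).prod
      = setPartition lam (V \ {u | u ∈ ws}) / setPartition lam V := by
  induction ws generalizing V with
  | nil => simp [children, (setPartition_pos hlam V).ne']
  | cons w ws ih =>
    rw [children, sdiff_setOf_mem_cons, sdiff_right_comm]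
    split_ifs with hw
    · rw [List.map_cons, List.prod_cons, ih, vacancy, mul_comm,
        div_mul_div_cancel₀ (setPartition_pos hlam _).ne']
    · rw [ih, Set.sdiff_singleton_eq_self hw]

theorem cavityStep_vacancy (hlam : 0 ≤ lam) {V : Set (Node d)} (hV : V.Finite) {v : Node d}
    (hv : v ∈ V) : cavityStep lam (vacancy lam) V v = vacancy lam V v := by
  have hpos := setPartition_pos hlam (V \ {v})
  rw [cavityStep, prod_children_vacancy hlam, vacancy, setPartition_eq_add lam hV hv]
  field_simp

theorem iterate_vacancy (hlam : 0 ≤ lam) (t : ℕ) {V : Set (Node d)} (hV : V.Finite) {v : Node d}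
    (hv : v ∈ V) : (cavityStep lam)^[t] (vacancy lam) V v = vacancy lam V v := by
  induction t generalizing V v with
  | zero => rfl
  | succ t ih =>
    rw [Function.iterate_succ_apply', ← cavityStep_vacancy hlam hV hv, cavityStep, cavityStep]
    congr 4
    refine List.map_congr_left fun c hc => ?_
    obtain ⟨-, hmem, hsub⟩ := mem_children hc
    exact ih (hV.subset (hsub.trans Set.sdiff_subset)) hmem

theorem vacancy_mem_Icc (hlam : 0 ≤ lam) : (vacancy lam : Marginal d) ∈ Set.Icc 0 1 :=
  ⟨fun V _ => (div_pos (setPartition_pos hlam _) (setPartition_pos hlam V)).le, fun V v =>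
    (div_le_one (setPartition_pos hlam V)).2 (setPartition_sdiff_singleton_le hlam V v)⟩

theorem vacancy_mem_admissible (hlam : 0 ≤ lam) : vacancy lam ∈ admissible d lam := by
  refine ⟨fun V v => ?_, (vacancy_mem_Icc hlam).2⟩
  by_cases h : V.Finite ∧ v ∈ V
  · rw [← cavityStep_vacancy hlam h.1 h.2]
    exact (mapsTo_cavityStep hlam (vacancy_mem_Icc hlam)).1 V v
  · have vacancy_eq_one : vacancy lam V v = 1 := by
      by_cases hv : v ∈ V
      · have hV : ¬ V.Finite := fun hV => h ⟨hV, hv⟩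
        have hV' : ¬ (V \ {v}).Finite := fun h => hV (h.of_sdiff (Set.finite_singleton v))
        rw [vacancy, setPartition, setPartition, dif_neg hV, dif_neg hV', div_one]
      · rw [vacancy, Set.sdiff_singleton_eq_self hv, div_self (setPartition_pos hlam V).ne']
    rw [vacancy_eq_one]
    exact (one_mem_admissible hlam).1 V v

end PartitionFunction

section SiteEnergy

variable {d : ℕ} {lam C κ : ℝ}

/-- The depth-`t` approximation `-log Φ_V(v, t)` of the contribution of `v` to the logarithm of
the partition function of `V`. -/
noncomputable def truncatedEnergy (lam : ℝ) (V : Set (Node d)) (v : Node d) (t : ℕ) : ℝ :=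
  -Real.log ((cavityStep lam)^[t] 1 V v)

/-- The contribution of `v` to the logarithm of the partition function of `V`: for finite `V` it
is `log Z_V - log Z_{V ∖ v}`, and for infinite `V` it is given a meaning as the limit of the
truncated energies. -/
noncomputable def siteEnergy (lam : ℝ) (V : Set (Node d)) (v : Node d) : ℝ :=
  Filter.limUnder Filter.atTop (truncatedEnergy lam V v)

namespace SpatialMixing

variable (hmix : SpatialMixing d lam C κ) {V V' : Set (Node d)} {v v' : Node d}

include hmix

theorem abs_truncatedEnergy_add_sub_le (hv : Exposed V v) (t s : ℕ) :
    |truncatedEnergy lam V v (t + s) - truncatedEnergy lam V v t| ≤ C * κ ^ t := by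
  have one_mem := one_mem_admissible (d := d) hmix.activity_nonneg
  rw [truncatedEnergy, truncatedEnergy, Function.iterate_add_apply, neg_sub_neg]
  exact hmix.abs_log_iterate_sub_le one_mem
    (mapsTo_iterate_admissible hmix.activity_nonneg s one_mem) t hv

theorem tendsto_truncatedEnergy (hv : Exposed V v) :
    Filter.Tendsto (truncatedEnergy lam V v) Filter.atTop (nhds (siteEnergy lam V v)) := by
  refine (cauchySeq_of_le_geometric κ C hmix.rate_lt_one fun t => ?_).tendsto_limUnder
  rw [dist_comm, Real.dist_eq]
  exact hmix.abs_truncatedEnergy_add_sub_le hv t 1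

theorem abs_siteEnergy_sub_truncatedEnergy_le (hv : Exposed V v) (t : ℕ) :
    |siteEnergy lam V v - truncatedEnergy lam V v t| ≤ C * κ ^ t := by
  have h := ((hmix.tendsto_truncatedEnergy hv).comp (Filter.tendsto_add_atTop_nat t)).sub_const
    (truncatedEnergy lam V v t)
  refine le_of_tendsto h.abs (Filter.Eventually.of_forall fun s => ?_)
  simp only [Function.comp_apply, add_comm s t]
  exact hmix.abs_truncatedEnergy_add_sub_le hv t s

theorem abs_siteEnergy_sub_siteEnergy_le (hv : Exposed V v) (hv' : Exposed V' v') {t : ℕ}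
    (h : AgreeNear t V v V' v') :
    |siteEnergy lam V v - siteEnergy lam V' v'| ≤ 2 * C * κ ^ t := by
  have truncatedEnergy_eq : truncatedEnergy lam V v t = truncatedEnergy lam V' v' t :=
    congrArg (fun x => -Real.log x) (h.iterate_const_eq 1)
  have h₁ := hmix.abs_siteEnergy_sub_truncatedEnergy_le hv t
  have h₂ := hmix.abs_siteEnergy_sub_truncatedEnergy_le hv' t
  rw [truncatedEnergy_eq] at h₁
  rw [abs_sub_comm] at h₂
  linarith [abs_sub_le (siteEnergy lam V v) (truncatedEnergy lam V' v' t) (siteEnergy lam V' v')]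

theorem siteEnergy_eq_log_sub_log (hV : V.Finite) (hvV : v ∈ V) (hv : Exposed V v) :
    siteEnergy lam V v = Real.log (setPartition lam V) - Real.log (setPartition lam (V \ {v})) := by
  have hlam := hmix.activity_nonneg
  have tendsto_vacancy :
      Filter.Tendsto (truncatedEnergy lam V v) Filter.atTop
        (nhds (-Real.log (vacancy lam V v))) := by
    rw [tendsto_iff_dist_tendsto_zero]
    refine squeeze_zero (fun _ => dist_nonneg) (g := fun t => C * κ ^ t) (fun t => ?_) ?_
    · have h := hmix.abs_log_iterate_sub_le (vacancy_mem_admissible hlam)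
        (one_mem_admissible hlam) t hv
      rw [iterate_vacancy hlam t hV hvV] at h
      rwa [Real.dist_eq, truncatedEnergy, neg_sub_neg]
    · simpa using (tendsto_pow_atTop_nhds_zero_of_lt_one hmix.rate_nonneg
        hmix.rate_lt_one).const_mul C
  rw [tendsto_nhds_unique (hmix.tendsto_truncatedEnergy hv) tendsto_vacancy, vacancy,
    Real.log_div (setPartition_pos hlam _).ne' (setPartition_pos hlam _).ne']
  ring

-- Two applications of the recursion are monotone, and the constant 1 is the largest start.
theorem truncatedEnergy_two_mul_le_siteEnergy (hv : Exposed V v) (t : ℕ) :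
    truncatedEnergy lam V v (2 * t) ≤ siteEnergy lam V v := by
  refine ge_of_tendsto ((hmix.tendsto_truncatedEnergy hv).comp
    (Filter.tendsto_add_atTop_nat (2 * t))) (Filter.Eventually.of_forall fun s => ?_)
  have hlam := hmix.activity_nonneg
  have hpos : 0 < (1 + lam)⁻¹ := by positivity
  have iterate_mem := mapsTo_iterate_admissible (d := d) hlam s (one_mem_admissible hlam)
  simp only [Function.comp_apply, truncatedEnergy, add_comm s, Function.iterate_add_apply]
  refine neg_le_neg (Real.log_le_log (hpos.trans_le
    ((mapsTo_iterate_admissible hlam (2 * t) iterate_mem).1 V v)) ?_)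
  exact monotoneOn_iterate_two_mul hlam t (admissible_subset_Icc hlam iterate_mem)
    (admissible_subset_Icc hlam (one_mem_admissible hlam)) iterate_mem.2 V v

theorem siteEnergy_le_neg_log_iterate_zero (hv : Exposed V v) {t : ℕ} (ht : 0 < t) :
    siteEnergy lam V v ≤ -Real.log ((cavityStep lam)^[2 * t] 0 V v) := by
  refine le_of_tendsto ((hmix.tendsto_truncatedEnergy hv).comp
    (Filter.tendsto_add_atTop_nat (2 * t))) (Filter.Eventually.of_forall fun s => ?_)
  have hlam := hmix.activity_nonneg
  have hpos : 0 < (1 + lam)⁻¹ := by positivity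
  have zero_mem : (0 : Marginal d) ∈ Set.Icc 0 1 := ⟨le_rfl, zero_le_one⟩
  have iterate_mem :=
    mapsTo_iterate_Icc (d := d) hlam s (admissible_subset_Icc hlam (one_mem_admissible hlam))
  simp only [Function.comp_apply, truncatedEnergy, add_comm s, Function.iterate_add_apply]
  refine neg_le_neg (Real.log_le_log (hpos.trans_le ?_) ?_)
  · obtain ⟨k, hk⟩ : ∃ k, 2 * t = k + 1 := ⟨2 * t - 1, by lia⟩
    rw [hk, Function.iterate_succ_apply']
    exact (mapsTo_cavityStep hlam (mapsTo_iterate_Icc hlam k zero_mem)).1 V v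
  · exact monotoneOn_iterate_two_mul hlam t zero_mem iterate_mem iterate_mem.1 V v

theorem abs_log_iterate_one_sub_log_iterate_zero_le (hv : Exposed V v) (t : ℕ) :
    |Real.log ((cavityStep lam)^[t + 1] 1 V v) - Real.log ((cavityStep lam)^[t + 1] 0 V v)|
      ≤ C * κ ^ t := by
  have hlam := hmix.activity_nonneg
  exact hmix.abs_log_iterate_sub_le
    (mapsTo_cavityStep hlam (admissible_subset_Icc hlam (one_mem_admissible hlam)))
    (mapsTo_cavityStep hlam ⟨le_rfl, zero_le_one⟩) t hv

end SpatialMixing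

end SiteEnergy

section LexicographicOrder

variable {d : ℕ}

/-- The nodes that precede `v` lexicographically, and `v` itself. Uncovering the nodes of a graph
in this order, one meets `v` when the graph is intersected with this set. -/
def lexBelow (v : Node d) : Set (Node d) := {u | LexLT u v ∨ u = v}

theorem mem_lexBelow {u v : Node d} : u ∈ lexBelow v ↔ toColex u ≤ toColex v := by
  have lexLT_iff : LexLT u v ↔ toColex u < toColex v :=
    exists_congr fun _ => and_comm
  rw [le_iff_lt_or_eq, toColex_inj]
  exact or_congr_left lexLT_iff

theorem add_mem_lexBelow {u v : Node d} : v + u ∈ lexBelow v ↔ u ∈ lexBelow 0 := by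
  simp [lexBelow, LexLT]

theorem exposed_lexBelow (hd : 0 < d) (v : Node d) : Exposed (lexBelow v) v := by
  refine ⟨Function.update v ⟨0, hd⟩ (v ⟨0, hd⟩ + 1), adj_update (by simp), ?_⟩
  rw [mem_lexBelow, Pi.toColex_update_le_self_iff]
  lia

theorem exposed_inter_lexBelow (hd : 0 < d) (Λ : Set (Node d)) (v : Node d) :
    Exposed (Λ ∩ lexBelow v) v :=
  (exposed_lexBelow hd v).mono Set.inter_subset_right

theorem Domain.exposed_cavityNodes (hd : 0 < d) (D : Domain d) : Exposed D.cavityNodes 0 :=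
  exposed_inter_lexBelow hd D.nodes 0

theorem agreeNear_inter_lexBelow {Λ Λ' : Set (Node d)} {v v' : Node d} {t : ℕ}
    (h : AgreeNear t Λ v Λ' v') : AgreeNear t (Λ ∩ lexBelow v) v (Λ' ∩ lexBelow v') v' :=
  fun u hu => by
    rw [Set.mem_inter_iff, Set.mem_inter_iff, add_mem_lexBelow, add_mem_lexBelow, h u hu]

theorem insert_inter_lexBelow_of_lt {Λ : Set (Node d)} {u v : Node d}
    (h : toColex v < toColex u) : insert u Λ ∩ lexBelow v = Λ ∩ lexBelow v :=
  Set.insert_inter_of_notMem fun hu => (mem_lexBelow.1 hu).not_gt h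

theorem SpatialMixing.log_partitionFunction_eq_sum {lam C κ : ℝ} (hmix : SpatialMixing d lam C κ)
    (hd : 0 < d) (Λ : Finset (Node d)) :
    Real.log (partitionFunction d lam Λ) = ∑ v ∈ Λ, siteEnergy lam (Λ ∩ lexBelow v) v := by
  classical
  induction Λ using Finset.induction_on_max_value (fun v : Node d => toColex v) with
  | empty => simp [partitionFunction_empty]
  | insert u Λ hu hmax ih =>
    have inter_lexBelow_max : (↑(insert u Λ) : Set (Node d)) ∩ lexBelow u = ↑(insert u Λ) :=
      Set.inter_eq_left.2 fun v hv => mem_lexBelow.2 <|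
        (Finset.mem_insert.1 (Finset.mem_coe.1 hv)).elim (fun h => h ▸ le_rfl) (hmax v)
    have siteEnergy_max : siteEnergy lam (↑(insert u Λ) ∩ lexBelow u) u
        = Real.log (partitionFunction d lam (insert u Λ))
          - Real.log (partitionFunction d lam Λ) := by
      rw [inter_lexBelow_max, hmix.siteEnergy_eq_log_sub_log (Finset.finite_toSet _) (by simp)
        ((exposed_lexBelow hd u).mono (Set.inter_eq_left.1 inter_lexBelow_max)),
        ← Finset.coe_erase, Finset.erase_insert hu, setPartition_coe, setPartition_coe]
    have siteEnergy_rest : ∀ v ∈ Λ, siteEnergy lam (↑(insert u Λ) ∩ lexBelow v) v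
        = siteEnergy lam (Λ ∩ lexBelow v) v := fun v hv => by
      have hvu : toColex v < toColex u :=
        (hmax v hv).lt_of_ne fun h => hu (toColex_inj.1 h ▸ hv)
      rw [Finset.coe_insert, insert_inter_lexBelow_of_lt hvu]
    rw [Finset.sum_insert hu, siteEnergy_max, Finset.sum_congr rfl siteEnergy_rest, ← ih,
      sub_add_cancel]

end LexicographicOrder

section FreeEnergy

variable {d : ℕ} {lam C κ : ℝ}

/-- The limit of `-log Φ(t)` at the origin of the cavity region of `D`. -/
noncomputable def Domain.energy (lam : ℝ) (D : Domain d) : ℝ :=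
  siteEnergy lam D.cavityNodes 0

theorem Domain.zero_mem_nodes (D : Domain d) : (0 : Node d) ∈ D.nodes := by
  cases D with
  | whole => trivial
  | upper j k => exact Int.natCast_nonneg k
  | lower j k => exact neg_nonpos.2 (Int.natCast_nonneg k)

namespace SpatialMixing

variable (hmix : SpatialMixing d lam C κ)

include hmix

theorem constant_nonneg (hd : 0 < d) : 0 ≤ C := by
  have one_mem := one_mem_admissible (d := d) hmix.activity_nonneg
  simpa using hmix.abs_log_iterate_sub_le one_mem one_mem 0 (exposed_lexBelow hd 0)

theorem abs_siteEnergy_sub_energy_le (hd : 0 < d) {Λ : Set (Node d)} {v : Node d} {D : Domain d}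
    {t : ℕ} (h : AgreeNear t Λ v D.nodes 0) :
    |siteEnergy lam (Λ ∩ lexBelow v) v - D.energy lam| ≤ 2 * C * κ ^ t :=
  hmix.abs_siteEnergy_sub_siteEnergy_le (exposed_inter_lexBelow hd Λ v)
    (D.exposed_cavityNodes hd) (agreeNear_inter_lexBelow h)

theorem abs_siteEnergy_sub_energy_le_of_mem (hd : 0 < d) {Λ : Set (Node d)} {v : Node d}
    (hv : v ∈ Λ) (D : Domain d) :
    |siteEnergy lam (Λ ∩ lexBelow v) v - D.energy lam| ≤ 2 * C := by
  have agreeNear_zero : AgreeNear 0 Λ v D.nodes 0 := fun u hu => by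
    obtain rfl : u = 0 := funext fun i => by simpa using hu i
    simpa [hv] using D.zero_mem_nodes
  simpa using hmix.abs_siteEnergy_sub_energy_le hd agreeNear_zero

end SpatialMixing

theorem exists_adj_abs_le {u : Node d} (hu : u ≠ 0) :
    ∃ w, (lattice d).Adj w u ∧ (∀ i, |w i| ≤ |u i|) ∧
      ∑ i, (w i).natAbs < ∑ i, (u i).natAbs := by
  obtain ⟨i, hi⟩ := Function.ne_iff.1 hu
  rw [Pi.zero_apply] at hi
  obtain ⟨x, hx, abs_le, natAbs_lt⟩ :
      ∃ x : ℤ, |u i - x| = 1 ∧ |x| ≤ |u i| ∧ x.natAbs < (u i).natAbs := by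
    rcases lt_or_gt_of_ne hi with h | h
    · exact ⟨u i + 1, by simp, by rw [abs_of_neg h, abs_le]; lia, by lia⟩
    · exact ⟨u i - 1, by simp, by rw [abs_of_pos h, abs_le]; lia, by lia⟩
  refine ⟨Function.update u i x, (adj_update hx).symm, fun j => ?_,
    Finset.sum_lt_sum (fun j _ => ?_) ⟨i, Finset.mem_univ i, by simpa using natAbs_lt⟩⟩
  · rcases eq_or_ne j i with rfl | hj
    · simpa using abs_le
    · rw [Function.update_of_ne hj]
  · rcases eq_or_ne j i with rfl | hj
    · simpa using natAbs_lt.le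
    · rw [Function.update_of_ne hj]

theorem exists_mem_boundary {Λ : Finset (Node d)} {v u : Node d} (hv : v ∈ Λ)
    (huΛ : v + u ∉ Λ) : ∃ z ∈ boundary Λ, ∀ i, |z i - v i| ≤ |u i| := by
  classical
  induction hn : ∑ i, (u i).natAbs using Nat.strong_induction_on generalizing u with
  | _ n ih =>
    have hu : u ≠ 0 := by
      rintro rfl
      exact huΛ (by rwa [add_zero])
    obtain ⟨w, hadj, abs_le, sum_lt⟩ := exists_adj_abs_le hu
    by_cases hw : v + w ∈ Λ
    · have hadj' : (lattice d).Adj (v + w) (v + u) := by simpa [lattice] using hadj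
      exact ⟨v + w, Finset.mem_filter.2 ⟨hw, v + u, hadj', huΛ⟩, fun i => by simpa using abs_le i⟩
    · obtain ⟨z, hz, h⟩ := ih _ (hn ▸ sum_lt) hw rfl
      exact ⟨z, hz, fun i => (h i).trans (abs_le i)⟩

open Classical in
/-- The nodes of `Λ` within sup-distance `t` of the complement of `Λ`. -/
noncomputable def nearComplement (t : ℕ) (Λ : Finset (Node d)) : Finset (Node d) :=
  Λ.filter fun v => ∃ u : Node d, (∀ i, |u i| ≤ t) ∧ v + u ∉ Λ

theorem mem_nearComplement {t : ℕ} {Λ : Finset (Node d)} {v : Node d} :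
    v ∈ nearComplement t Λ ↔ v ∈ Λ ∧ ∃ u : Node d, (∀ i, |u i| ≤ t) ∧ v + u ∉ Λ := by
  classical exact Finset.mem_filter

theorem card_nearComplement_le (t : ℕ) (Λ : Finset (Node d)) :
    (nearComplement t Λ).card ≤ (boundary Λ).card * (2 * t + 1) ^ d := by
  classical
  have subset_biUnion : nearComplement t Λ ⊆ (boundary Λ).biUnion fun z =>
      Fintype.piFinset fun i => Finset.Icc (z i - t) (z i + t) := by
    intro v hv
    obtain ⟨hvΛ, u, hu, huΛ⟩ := mem_nearComplement.1 hv
    obtain ⟨z, hz, h⟩ := exists_mem_boundary hvΛ huΛ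
    refine Finset.mem_biUnion.2 ⟨z, hz, Fintype.mem_piFinset.2 fun i => ?_⟩
    have := abs_le.1 ((h i).trans (hu i))
    rw [Finset.mem_Icc]
    lia
  refine (Finset.card_le_card subset_biUnion).trans
    (Finset.card_biUnion_le_card_mul _ _ _ fun z _ => ?_)
  have card_Icc (i : Fin d) : (Finset.Icc (z i - t) (z i + t)).card = 2 * t + 1 := by
    rw [Int.card_Icc]
    lia
  simp [Fintype.card_piFinset, card_Icc]

theorem agreeNear_whole {Λ : Finset (Node d)} {t : ℕ} {v : Node d} (hv : v ∈ Λ)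
    (hv' : v ∉ nearComplement t Λ) : AgreeNear t Λ v (Domain.whole : Domain d).nodes 0 :=
  fun u hu => iff_of_true
    (by_contra fun huΛ => hv' (mem_nearComplement.2 ⟨hv, u, hu, huΛ⟩)) trivial

theorem SpatialMixing.abs_log_partitionFunction_sub_le (hmix : SpatialMixing d lam C κ)
    (hd : 0 < d) (Λ : Finset (Node d)) (t : ℕ) :
    |Real.log (partitionFunction d lam Λ) - Λ.card * (Domain.whole : Domain d).energy lam|
      ≤ Λ.card * (2 * C * κ ^ t) + (boundary Λ).card * ((2 * t + 1) ^ d * (2 * C)) := by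
  classical
  have hC := hmix.constant_nonneg hd
  have hκ := hmix.rate_nonneg
  set P := (Domain.whole : Domain d).energy lam
  have abs_sub_le : ∀ v ∈ Λ, |siteEnergy lam (Λ ∩ lexBelow v) v - P|
      ≤ 2 * C * κ ^ t + if v ∈ nearComplement t Λ then 2 * C else 0 := fun v hv => by
    split_ifs with h
    · exact (hmix.abs_siteEnergy_sub_energy_le_of_mem hd (Finset.mem_coe.2 hv) _).trans
        (le_add_of_nonneg_left (by positivity))
    · rw [add_zero]
      exact hmix.abs_siteEnergy_sub_energy_le hd (agreeNear_whole hv h)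
  have inter_eq : Λ ∩ nearComplement t Λ = nearComplement t Λ :=
    Finset.inter_eq_right.2 fun _ hv => (mem_nearComplement.1 hv).1
  have card_le : ((nearComplement t Λ).card : ℝ) ≤ (boundary Λ).card * (2 * t + 1) ^ d := by
    exact_mod_cast card_nearComplement_le t Λ
  calc |Real.log (partitionFunction d lam Λ) - Λ.card * P|
      = |∑ v ∈ Λ, (siteEnergy lam (Λ ∩ lexBelow v) v - P)| := by
        rw [hmix.log_partitionFunction_eq_sum hd, Finset.sum_sub_distrib, Finset.sum_const,
          nsmul_eq_mul]
    _ ≤ ∑ v ∈ Λ, (2 * C * κ ^ t + if v ∈ nearComplement t Λ then 2 * C else 0) :=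
        (Finset.abs_sum_le_sum_abs _ _).trans (Finset.sum_le_sum abs_sub_le)
    _ = Λ.card * (2 * C * κ ^ t) + (nearComplement t Λ).card * (2 * C) := by
        rw [Finset.sum_add_distrib, Finset.sum_ite_mem, inter_eq]
        simp only [Finset.sum_const, nsmul_eq_mul]
    _ ≤ _ := by
        rw [← mul_assoc ((boundary Λ).card : ℝ)]
        gcongr

theorem SpatialMixing.hasFreeEnergy (hmix : SpatialMixing d lam C κ) (hd : 0 < d) :
    HasFreeEnergy d lam ((Domain.whole : Domain d).energy lam) := by
  intro Λ hne hboundary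
  rw [Metric.tendsto_atTop]
  intro δ hδ
  have tendsto_geometric : Filter.Tendsto (fun t => 2 * C * κ ^ t) Filter.atTop (nhds 0) := by
    simpa using (tendsto_pow_atTop_nhds_zero_of_lt_one hmix.rate_nonneg
      hmix.rate_lt_one).const_mul (2 * C)
  obtain ⟨t, ht⟩ := (tendsto_geometric.eventually_lt_const (half_pos hδ)).exists
  have tendsto_boundary := hboundary.mul_const ((2 * t + 1 : ℝ) ^ d * (2 * C))
  rw [zero_mul] at tendsto_boundary
  obtain ⟨n₀, hn₀⟩ :=
    Filter.eventually_atTop.1 (tendsto_boundary.eventually_lt_const (half_pos hδ))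
  refine ⟨n₀, fun n hn => ?_⟩
  have hcard : (0 : ℝ) < (Λ n).card := by exact_mod_cast (hne n).card_pos
  have boundary_lt := hn₀ n hn
  rw [div_mul_eq_mul_div, div_lt_iff₀ hcard] at boundary_lt
  rw [Real.dist_eq, div_sub' hcard.ne', abs_div, abs_of_pos hcard, div_lt_iff₀ hcard]
  calc _ ≤ (Λ n).card * (2 * C * κ ^ t) + (boundary (Λ n)).card * ((2 * t + 1) ^ d * (2 * C)) :=
        hmix.abs_log_partitionFunction_sub_le hd (Λ n) t
    _ < (Λ n).card * (δ / 2) + δ / 2 * (Λ n).card := by gcongr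
    _ = δ * (Λ n).card := by ring

end FreeEnergy

section Box

variable {d : ℕ}

/-- The box `{v : |v_j| ≤ N_j for all j}`. -/
noncomputable def box (N : Fin d → ℕ) : Finset (Node d) :=
  Fintype.piFinset fun j => Finset.Icc (-(N j : ℤ)) (N j)

theorem mem_box {N : Fin d → ℕ} {v : Node d} :
    v ∈ box N ↔ ∀ j, -(N j : ℤ) ≤ v j ∧ v j ≤ N j := by
  simp only [box, Fintype.mem_piFinset, Finset.mem_Icc]

/-- The number of nodes in a section of the box in which the coordinates with index in `S` are
fixed. It is a real number, since it is only used as a weight. -/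
noncomputable def sectionCard (N : Fin d → ℕ) (S : Finset (Fin d)) : ℝ :=
  ∏ i ∈ Sᶜ, (2 * (N i : ℝ) + 1)

theorem sum_box_prod (N : Fin d → ℕ) (S : Finset (Fin d)) (g : Fin d → ℤ → ℝ) :
    ∑ v ∈ box N, ∏ i ∈ S, g i (v i)
      = sectionCard N S * ∏ i ∈ S, ∑ x ∈ Finset.Icc (-(N i : ℤ)) (N i), g i x := by
  have sum_side (i : Fin d) : ∑ x ∈ Finset.Icc (-(N i : ℤ)) (N i), (if i ∈ S then g i x else 1)
      = if i ∈ S then ∑ x ∈ Finset.Icc (-(N i : ℤ)) (N i), g i x else 2 * (N i : ℝ) + 1 := by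
    split_ifs
    · rfl
    · have card_side : (Finset.Icc (-(N i : ℤ)) (N i)).card = 2 * N i + 1 := by
        rw [Int.card_Icc]
        lia
      simp [card_side]
  calc ∑ v ∈ box N, ∏ i ∈ S, g i (v i)
      = ∑ v ∈ box N, ∏ i, if i ∈ S then g i (v i) else 1 :=
        Finset.sum_congr rfl fun v _ => (Fintype.prod_ite_mem S fun i => g i (v i)).symm
    _ = ∏ i, ∑ x ∈ Finset.Icc (-(N i : ℤ)) (N i), if i ∈ S then g i x else 1 :=
        (Finset.prod_univ_sum _ fun i x => if i ∈ S then g i x else 1).symm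
    _ = sectionCard N S * ∏ i ∈ S, ∑ x ∈ Finset.Icc (-(N i : ℤ)) (N i), g i x := by
        rw [Finset.prod_congr rfl fun i _ => sum_side i, Finset.prod_ite, sectionCard, mul_comm]
        congr 2 <;> ext <;> simp

theorem card_box (N : Fin d → ℕ) (j : Fin d) :
    ((box N).card : ℝ) = sectionCard N {j} * (2 * N j + 1) := by
  have h := sum_box_prod N ∅ fun _ _ => 1
  simp only [Finset.prod_empty, Finset.sum_const, nsmul_one, mul_one] at h
  rw [h, sectionCard, sectionCard, Finset.compl_empty, Finset.compl_singleton, mul_comm]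
  exact (Finset.mul_prod_erase _ (fun i => 2 * (N i : ℝ) + 1) (Finset.mem_univ j)).symm

/-- The distance of a coordinate `x ∈ {-n, …, n}` to the upper end (for `true`) or the lower end
(for `false`). -/
def sideDepth (n : ℕ) (s : Bool) (x : ℤ) : ℕ := bif s then (n - x).toNat else (x + n).toNat

theorem sum_sideDepth (n : ℕ) (s : Bool) (h : ℕ → ℝ) :
    ∑ x ∈ Finset.Icc (-(n : ℤ)) n, h (sideDepth n s x) = ∑ k ∈ Finset.range (2 * n + 1), h k := by
  refine Finset.sum_bij' (fun x _ => sideDepth n s x)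
    (fun k _ => bif s then (n : ℤ) - k else k - n) ?_ ?_ ?_ ?_ fun _ _ => rfl <;>
  cases s <;> simp only [sideDepth, cond_true, cond_false, Finset.mem_Icc, Finset.mem_range] <;>
  lia

theorem sum_box_prod_sideDepth (N : Fin d → ℕ) (S : Finset (Fin d)) (s : Fin d → Bool)
    (h : ℕ → ℝ) :
    ∑ v ∈ box N, ∏ i ∈ S, h (sideDepth (N i) (s i) (v i))
      = sectionCard N S * ∏ i ∈ S, ∑ k ∈ Finset.range (2 * N i + 1), h k := by
  rw [sum_box_prod N S fun i x => h (sideDepth (N i) (s i) x)]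
  simp only [sum_sideDepth]

/-- The faces of a box: `(j, true)` is the one with the largest, `(j, false)` the one with the
smallest `j`-th coordinate. -/
abbrev Face (d : ℕ) : Type := Fin d × Bool

/-- The distance of the node `v` of the box `N` to the face `f`. -/
def faceDepth (N : Fin d → ℕ) (f : Face d) (v : Node d) : ℕ := sideDepth (N f.1) f.2 (v f.1)

theorem sum_faceDepth (N : Fin d → ℕ) (f : Face d) (h : ℕ → ℝ) :
    ∑ v ∈ box N, h (faceDepth N f v)
      = sectionCard N {f.1} * ∑ k ∈ Finset.range (2 * N f.1 + 1), h k := by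
  simpa [faceDepth] using sum_box_prod_sideDepth N {f.1} (fun _ => f.2) h

theorem sum_faceDepth_mul_faceDepth (N : Fin d → ℕ) {f f' : Face d} (hf : f.1 ≠ f'.1)
    (h : ℕ → ℝ) :
    ∑ v ∈ box N, h (faceDepth N f v) * h (faceDepth N f' v)
      = sectionCard N {f.1, f'.1} * ((∑ k ∈ Finset.range (2 * N f.1 + 1), h k) *
          ∑ k ∈ Finset.range (2 * N f'.1 + 1), h k) := by
  simpa [faceDepth, Finset.prod_pair hf, hf.symm] using
    sum_box_prod_sideDepth N {f.1, f'.1} (fun i => if i = f.1 then f.2 else f'.2) h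

theorem faceDepth_add_faceDepth {N : Fin d → ℕ} {v : Node d} (hv : v ∈ box N)
    {f f' : Face d} (hne : f ≠ f') (hj : f.1 = f'.1) :
    faceDepth N f v + faceDepth N f' v = 2 * N f.1 := by
  obtain ⟨j, s⟩ := f
  obtain ⟨j', s'⟩ := f'
  obtain rfl : j = j' := hj
  have := mem_box.1 hv j
  cases s <;> cases s' <;> simp only [ne_eq, not_true_eq_false] at hne <;>
    simp only [faceDepth, sideDepth, cond_true, cond_false] <;> lia

theorem sum_pow_faceDepth_of_opposite (x : ℝ) (N : Fin d → ℕ) {f f' : Face d} (hne : f ≠ f')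
    (hj : f.1 = f'.1) :
    ∑ v ∈ box N, x ^ faceDepth N f v * x ^ faceDepth N f' v
      = sectionCard N {f.1} * ((2 * N f.1 + 1) * x ^ (2 * N f.1)) := by
  rw [Finset.sum_congr rfl fun v hv => by rw [← pow_add, faceDepth_add_faceDepth hv hne hj],
    Finset.sum_const, nsmul_eq_mul, card_box N f.1, mul_assoc]

/-- The half-space bounded by the face `f` at distance `k` from the origin. -/
def faceDomain (f : Face d) (k : ℕ) : Domain d :=
  bif f.2 then Domain.upper f.1 k else Domain.lower f.1 k

theorem mem_faceDomain_of_abs_le (f : Face d) {k : ℕ} {u : Node d} (hu : |u f.1| ≤ k) :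
    u ∈ (faceDomain f k).nodes := by
  obtain ⟨j, _ | _⟩ := f
  · exact (abs_le.1 hu).1
  · exact (abs_le.1 hu).2

theorem add_mem_box_iff {N : Fin d → ℕ} {v : Node d} (hv : v ∈ box N) (u : Node d) :
    v + u ∈ box N ↔ ∀ f, u ∈ (faceDomain f (faceDepth N f v)).nodes := by
  rw [mem_box] at hv
  have mem_lower (j : Fin d) : u ∈ (faceDomain (j, false) (faceDepth N (j, false) v)).nodes ↔
      -(N j : ℤ) ≤ v j + u j := by
    change -((v j + N j).toNat : ℤ) ≤ u j ↔ _
    have := hv j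
    lia
  have mem_upper (j : Fin d) : u ∈ (faceDomain (j, true) (faceDepth N (j, true) v)).nodes ↔
      v j + u j ≤ N j := by
    change u j ≤ ((N j - v j).toNat : ℤ) ↔ _
    have := hv j
    lia
  simp only [mem_box, Pi.add_apply, Prod.forall, Bool.forall_bool, mem_lower, mem_upper]

end Box

section BoxLimits

variable {d : ℕ} {N : ℕ → Fin d → ℕ} {a : Fin d → ℝ}
  (hN : ∀ j, Filter.Tendsto (fun n => (N n j : ℝ) / n) Filter.atTop (nhds (a j)))

include hN

theorem tendsto_sectionCard_div (S : Finset (Fin d)) :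
    Filter.Tendsto (fun n : ℕ => sectionCard (N n) S / (n : ℝ) ^ Sᶜ.card) Filter.atTop
      (nhds (∏ i ∈ Sᶜ, 2 * a i)) := by
  have tendsto_side (i : Fin d) :
      Filter.Tendsto (fun n : ℕ => (2 * (N n i : ℝ) + 1) / n) Filter.atTop (nhds (2 * a i)) := by
    have h := ((hN i).const_mul 2).add (tendsto_inv_atTop_nhds_zero_nat (𝕜 := ℝ))
    rw [add_zero] at h
    exact h.congr fun n => by ring
  refine (tendsto_finsetProd Sᶜ fun i _ => tendsto_side i).congr fun n => ?_
  rw [Finset.prod_div_distrib, Finset.prod_const, sectionCard]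

theorem tendsto_sectionCard_singleton (j : Fin d) :
    Filter.Tendsto (fun n : ℕ => sectionCard (N n) {j} / (n : ℝ) ^ (d - 1)) Filter.atTop
      (nhds (faceArea a j)) := by
  simpa [Finset.card_compl, Finset.compl_singleton, faceArea] using tendsto_sectionCard_div hN {j}

theorem tendsto_sectionCard_pair {j j' : Fin d} (hj : j ≠ j') :
    Filter.Tendsto (fun n : ℕ => sectionCard (N n) {j, j'} / (n : ℝ) ^ (d - 1)) Filter.atTop
      (nhds 0) := by
  have card_compl : ({j, j'} : Finset (Fin d))ᶜ.card + 1 = d - 1 := by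
    have := Finset.card_add_card_compl {j, j'}
    rw [Finset.card_pair hj, Fintype.card_fin] at this
    lia
  have h := (tendsto_sectionCard_div hN {j, j'}).mul (tendsto_inv_atTop_nhds_zero_nat (𝕜 := ℝ))
  rw [mul_zero] at h
  exact h.congr fun n => by rw [← card_compl, pow_succ, ← div_div, div_eq_mul_inv _ (n : ℝ)]

variable (ha : ∀ j, 0 < a j)

include ha

theorem tendsto_atTop_of_tendsto_div (j : Fin d) :
    Filter.Tendsto (fun n => N n j) Filter.atTop Filter.atTop := by
  refine tendsto_natCast_atTop_iff.1
    (((hN j).pos_mul_atTop (ha j) (tendsto_natCast_atTop_atTop (R := ℝ))).congr' ?_)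
  filter_upwards [Filter.eventually_ne_atTop 0] with n hn
  exact div_mul_cancel₀ _ (Nat.cast_ne_zero.2 hn)

theorem tendsto_sum_range_side {g : ℕ → ℝ} (hg : Summable g) (j : Fin d) :
    Filter.Tendsto (fun n => ∑ k ∈ Finset.range (2 * N n j + 1), g k) Filter.atTop
      (nhds (∑' k, g k)) :=
  hg.hasSum.tendsto_sum_nat.comp ((Filter.tendsto_add_atTop_nat 1).comp
    ((tendsto_atTop_of_tendsto_div hN ha j).const_mul_atTop' two_pos))

theorem tendsto_sum_pow_faceDepth_div {x : ℝ} (hx₀ : 0 ≤ x) (hx₁ : x < 1) {f f' : Face d}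
    (hne : f ≠ f') :
    Filter.Tendsto (fun n : ℕ =>
        (∑ v ∈ box (N n), x ^ faceDepth (N n) f v * x ^ faceDepth (N n) f' v) / (n : ℝ) ^ (d - 1))
      Filter.atTop (nhds 0) := by
  by_cases hj : f.1 = f'.1
  · have tendsto_opposite := ((tendsto_self_mul_const_pow_of_lt_one hx₀ hx₁).add
      (tendsto_pow_atTop_nhds_zero_of_lt_one hx₀ hx₁)).comp
        ((tendsto_atTop_of_tendsto_div hN ha f.1).const_mul_atTop' two_pos)
    have h := (tendsto_sectionCard_singleton hN f.1).mul tendsto_opposite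
    rw [add_zero, mul_zero] at h
    refine h.congr fun n => ?_
    rw [sum_pow_faceDepth_of_opposite x _ hne hj]
    simp only [Function.comp_apply]
    push_cast
    ring
  · have hsum := summable_geometric_of_lt_one hx₀ hx₁
    have h := (tendsto_sectionCard_pair hN hj).mul
      ((tendsto_sum_range_side hN ha hsum f.1).mul (tendsto_sum_range_side hN ha hsum f'.1))
    rw [zero_mul] at h
    refine h.congr fun n => ?_
    rw [sum_faceDepth_mul_faceDepth _ hj fun k => x ^ k]
    ring

end BoxLimits

section SurfacePressure

variable {d : ℕ} {lam C κ : ℝ}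

/-- The excess over the free energy of the contribution of a node at depth `k` below the face
`f`, when no other face is present. -/
noncomputable def faceExcess (lam : ℝ) (f : Face d) (k : ℕ) : ℝ :=
  (faceDomain f k).energy lam - (Domain.whole : Domain d).energy lam

/-- The surface pressure for the rectangular shape `a`, as a weighted sum over the faces. -/
noncomputable def surfaceSum (lam : ℝ) (a : Fin d → ℝ) : ℝ :=
  ∑ f : Face d, faceArea a f.1 / totalArea a * ∑' k, faceExcess lam f k

theorem exists_two_smallest {ι : Type*} [Finite ι] [Nontrivial ι] (g : ι → ℕ) :
    ∃ i j, i ≠ j ∧ g i ≤ g j ∧ ∀ k ≠ i, g j ≤ g k := by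
  classical
  have := Fintype.ofFinite ι
  obtain ⟨i, hi⟩ := Finite.exists_min g
  obtain ⟨j, hj, hmin⟩ := (Finset.univ.erase i).exists_min_image g
    ((exists_ne i).imp fun k hk => Finset.mem_erase.2 ⟨hk, Finset.mem_univ k⟩)
  exact ⟨i, j, (Finset.ne_of_mem_erase hj).symm, hi j,
    fun k hk => hmin k (Finset.mem_erase.2 ⟨hk, Finset.mem_univ k⟩)⟩

namespace SpatialMixing

variable (hmix : SpatialMixing d lam C κ)

include hmix

theorem abs_faceExcess_le (hd : 0 < d) (f : Face d) (k : ℕ) :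
    |faceExcess lam f k| ≤ 2 * C * κ ^ k :=
  hmix.abs_siteEnergy_sub_energy_le hd fun u hu =>
    iff_of_true (by simpa using mem_faceDomain_of_abs_le f (hu f.1)) trivial

theorem summable_faceExcess (hd : 0 < d) (f : Face d) : Summable (faceExcess lam f) :=
  Summable.of_norm_bounded
    ((summable_geometric_of_lt_one hmix.rate_nonneg hmix.rate_lt_one).mul_left (2 * C))
    fun k => hmix.abs_faceExcess_le hd f k

theorem sqrt_rate_lt_one : √κ < 1 := by
  rw [Real.sqrt_lt' one_pos, one_pow]
  exact hmix.rate_lt_one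

theorem abs_siteEnergy_box_sub_le_of_le_faceDepth (hd : 0 < d) {N : Fin d → ℕ} {v : Node d}
    (hv : v ∈ box N) {f : Face d} {t : ℕ} (ht : ∀ f' ≠ f, t ≤ faceDepth N f' v) :
    |siteEnergy lam (box N ∩ lexBelow v) v - (Domain.whole : Domain d).energy lam
        - ∑ f', faceExcess lam f' (faceDepth N f' v)| ≤ 4 * d * C * κ ^ t := by
  have hC := hmix.constant_nonneg hd
  have hκ := hmix.rate_nonneg
  set E := siteEnergy lam (box N ∩ lexBelow v) v
  have agreeNear : AgreeNear t (box N) v (faceDomain f (faceDepth N f v)).nodes 0 := by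
    intro u hu
    rw [Finset.mem_coe, add_mem_box_iff hv, zero_add]
    refine ⟨fun h => h f, fun h f' => ?_⟩
    rcases eq_or_ne f' f with rfl | hf
    · exact h
    · exact mem_faceDomain_of_abs_le f' ((hu f'.1).trans (by exact_mod_cast ht f' hf))
  have other_faces : |∑ f' ∈ Finset.univ.erase f, faceExcess lam f' (faceDepth N f' v)|
      ≤ (2 * d - 1) * (2 * C * κ ^ t) := by
    have card_erase : ((Finset.univ.erase f).card : ℝ) = 2 * d - 1 := by
      rw [Finset.card_erase_of_mem (Finset.mem_univ f), Finset.card_univ, Fintype.card_prod,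
        Fintype.card_fin, Fintype.card_bool, Nat.cast_sub (by lia)]
      push_cast
      ring
    rw [← card_erase, ← nsmul_eq_mul]
    refine (Finset.abs_sum_le_sum_abs _ _).trans (Finset.sum_le_card_nsmul _ _ _ fun f' hf' =>
      (hmix.abs_faceExcess_le hd f' _).trans ?_)
    exact mul_le_mul_of_nonneg_left (pow_le_pow_of_le_one hκ hmix.rate_lt_one.le
      (ht f' (Finset.ne_of_mem_erase hf'))) (by positivity)
  calc _ = |E - (faceDomain f (faceDepth N f v)).energy lam
        - ∑ f' ∈ Finset.univ.erase f, faceExcess lam f' (faceDepth N f' v)| := by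
        rw [← Finset.add_sum_erase _ _ (Finset.mem_univ f), faceExcess]
        ring_nf
    _ ≤ 2 * C * κ ^ t + (2 * d - 1) * (2 * C * κ ^ t) := (abs_sub _ _).trans
        (add_le_add (hmix.abs_siteEnergy_sub_energy_le hd agreeNear) other_faces)
    _ = 4 * d * C * κ ^ t := by ring

-- With `f₁` the nearest and `f₂` the second nearest face, the error is governed by the depth
-- below `f₂`, and `κ` to that power is at most the term of the pair `(f₁, f₂)`.
theorem abs_siteEnergy_box_sub_le (hd : 0 < d) {N : Fin d → ℕ} {v : Node d} (hv : v ∈ box N) :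
    |siteEnergy lam (box N ∩ lexBelow v) v - (Domain.whole : Domain d).energy lam
        - ∑ f, faceExcess lam f (faceDepth N f v)|
      ≤ 4 * d * C * ∑ p ∈ (Finset.univ : Finset (Face d)).offDiag,
          √κ ^ faceDepth N p.1 v * √κ ^ faceDepth N p.2 v := by
  have hC := hmix.constant_nonneg hd
  have : Nonempty (Fin d) := ⟨⟨0, hd⟩⟩
  obtain ⟨f₁, f₂, hne, depth_le, depth_min⟩ := exists_two_smallest fun f => faceDepth N f v
  have mem_offDiag : (f₁, f₂) ∈ (Finset.univ : Finset (Face d)).offDiag := by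
    simpa only [Finset.mem_offDiag, Finset.mem_univ, true_and] using hne
  refine (hmix.abs_siteEnergy_box_sub_le_of_le_faceDepth hd hv depth_min).trans
    (mul_le_mul_of_nonneg_left ?_ (by positivity))
  calc κ ^ faceDepth N f₂ v = √κ ^ (2 * faceDepth N f₂ v) := by
        rw [pow_mul, Real.sq_sqrt hmix.rate_nonneg]
    _ ≤ √κ ^ (faceDepth N f₁ v + faceDepth N f₂ v) :=
        pow_le_pow_of_le_one (Real.sqrt_nonneg κ) hmix.sqrt_rate_lt_one.le (by lia)
    _ = √κ ^ faceDepth N f₁ v * √κ ^ faceDepth N f₂ v := pow_add _ _ _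
    _ ≤ _ := Finset.single_le_sum
        (f := fun p : Face d × Face d => √κ ^ faceDepth N p.1 v * √κ ^ faceDepth N p.2 v)
        (fun p _ => by positivity) mem_offDiag

theorem abs_log_partitionFunction_box_sub_le (hd : 0 < d) (N : Fin d → ℕ) :
    |Real.log (partitionFunction d lam (box N))
        - (box N).card * (Domain.whole : Domain d).energy lam
        - ∑ f : Face d, sectionCard N {f.1} *
            ∑ k ∈ Finset.range (2 * N f.1 + 1), faceExcess lam f k|
      ≤ 4 * d * C * ∑ p ∈ (Finset.univ : Finset (Face d)).offDiag,
          ∑ v ∈ box N, √κ ^ faceDepth N p.1 v * √κ ^ faceDepth N p.2 v := by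
  simp only [← sum_faceDepth]
  rw [hmix.log_partitionFunction_eq_sum hd, Finset.sum_comm, ← nsmul_eq_mul, ← Finset.sum_const,
    ← Finset.sum_sub_distrib, ← Finset.sum_sub_distrib, Finset.sum_comm, Finset.mul_sum]
  exact (Finset.abs_sum_le_sum_abs _ _).trans
    (Finset.sum_le_sum fun v hv => hmix.abs_siteEnergy_box_sub_le hd hv)

theorem tendsto_log_partitionFunction_box_sub_div (hd : 0 < d) {N : ℕ → Fin d → ℕ}
    {a : Fin d → ℝ}
    (hN : ∀ j, Filter.Tendsto (fun n => (N n j : ℝ) / n) Filter.atTop (nhds (a j)))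
    (ha : ∀ j, 0 < a j) :
    Filter.Tendsto (fun n : ℕ => (Real.log (partitionFunction d lam (box (N n)))
        - (box (N n)).card * (Domain.whole : Domain d).energy lam) / (n : ℝ) ^ (d - 1))
      Filter.atTop (nhds (∑ f : Face d, faceArea a f.1 * ∑' k, faceExcess lam f k)) := by
  have tendsto_faces := tendsto_finsetSum Finset.univ fun (f : Face d) _ =>
    (tendsto_sectionCard_singleton hN f.1).mul
      (tendsto_sum_range_side hN ha (hmix.summable_faceExcess hd f) f.1)
  have tendsto_pairs := (tendsto_finsetSum (Finset.univ : Finset (Face d)).offDiag fun p hp =>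
    tendsto_sum_pow_faceDepth_div hN ha (Real.sqrt_nonneg κ) hmix.sqrt_rate_lt_one
      (Finset.mem_offDiag.1 hp).2.2).const_mul (4 * d * C)
  rw [Finset.sum_const_zero, mul_zero] at tendsto_pairs
  refine tendsto_of_tendsto_of_dist tendsto_faces
    (squeeze_zero (fun _ => dist_nonneg) (fun n => ?_) tendsto_pairs)
  simp only [div_mul_eq_mul_div]
  rw [dist_comm, Real.dist_eq, ← Finset.sum_div, ← Finset.sum_div, ← sub_div, abs_div,
    abs_of_nonneg (by positivity : (0 : ℝ) ≤ (n : ℝ) ^ (d - 1)), ← mul_div_assoc]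
  exact div_le_div_of_nonneg_right (hmix.abs_log_partitionFunction_box_sub_le hd (N n))
    (by positivity)

theorem hasSurfacePressure (hd : 0 < d) {a : Fin d → ℝ} (ha : ∀ j, 0 < a j) :
    HasSurfacePressure d lam ((Domain.whole : Domain d).energy lam) a (surfaceSum lam a) := by
  have rectangle_eq_box (n : ℕ) : rectangle a n = box fun j => ⌊a j * n⌋₊ := by
    unfold rectangle box
    simp only [Int.natCast_floor_eq_floor (mul_nonneg (ha _).le n.cast_nonneg)]
  have tendsto_floor (j : Fin d) :
      Filter.Tendsto (fun n : ℕ => (⌊a j * n⌋₊ : ℝ) / n) Filter.atTop (nhds (a j)) :=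
    (tendsto_nat_floor_mul_div_atTop (ha j).le).comp tendsto_natCast_atTop_atTop
  have surfaceSum_eq : surfaceSum lam a
      = (∑ f : Face d, faceArea a f.1 * ∑' k, faceExcess lam f k) / totalArea a := by
    simp only [surfaceSum, Finset.sum_div, div_mul_eq_mul_div]
  rw [HasSurfacePressure, surfaceSum_eq]
  refine ((hmix.tendsto_log_partitionFunction_box_sub_div hd tendsto_floor ha).div_const
    (totalArea a)).congr fun n => ?_
  rw [rectangle_eq_box, div_div, mul_comm (totalArea a)]

end SpatialMixing

end SurfacePressure

section Accuracy

variable {d : ℕ} {lam C κ : ℝ}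

theorem natCast_mul_pow_le (hκ0 : 0 ≤ κ) (hκ1 : κ < 1) (t : ℕ) : t * κ ^ t ≤ (1 - κ)⁻¹ :=
  calc t * κ ^ t = ∑ _k ∈ Finset.range t, κ ^ t := by
        rw [Finset.sum_const, Finset.card_range, nsmul_eq_mul]
    _ ≤ ∑ k ∈ Finset.range t, κ ^ k := Finset.sum_le_sum fun _ hk =>
        pow_le_pow_of_le_one hκ0 hκ1.le (Finset.mem_range.1 hk).le
    _ ≤ ∑' k, κ ^ k := (summable_geometric_of_lt_one hκ0 hκ1).sum_le_tsum _ fun k _ =>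
        pow_nonneg hκ0 k
    _ = (1 - κ)⁻¹ := tsum_geometric_of_lt_one hκ0 hκ1

theorem exists_level_constant (D : ℝ) (hκ0 : 0 ≤ κ) (hκ1 : κ < 1) :
    ∃ c : ℕ, 0 < c ∧ ∀ ε : ℝ, 0 < ε → D * κ ^ (level c ε).val ≤ ε := by
  have tendsto_pow := tendsto_pow_atTop_nhds_zero_of_lt_one hκ0 hκ1
  have tendsto_mul_pow : Filter.Tendsto (fun c => D * κ ^ c) Filter.atTop (nhds 0) := by
    simpa only [mul_zero] using tendsto_pow.const_mul D
  obtain ⟨c, pow_le_half, mul_pow_le_one, c_pos⟩ :=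
    ((tendsto_pow.eventually_le_const one_half_pos).and
      ((tendsto_mul_pow.eventually_le_const one_pos).and (Filter.eventually_gt_atTop 0))).exists
  refine ⟨c, c_pos, fun ε hε => ?_⟩
  calc D * κ ^ (level c ε).val = D * κ ^ c * (κ ^ c) ^ halvings ε := by
        rw [level_val, mul_add, mul_one, pow_add, pow_mul]
        ring
    _ ≤ 1 * (1 / 2) ^ halvings ε :=
        mul_le_mul mul_pow_le_one (pow_le_pow_left₀ (by positivity) pow_le_half _)
          (by positivity) zero_le_one
    _ ≤ ε := by
        rw [one_mul]
        exact half_pow_halvings_le hε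

theorem scaFreeEnergy_val (d : ℕ) (lam : ℝ) (c : ℕ) (ε : ℝ) :
    (scaFreeEnergy d lam c ε).val
      = (truncatedEnergy lam (Domain.whole : Domain d).cavityNodes 0 (2 * (level c ε).val),
        -Real.log ((cavityStep lam)^[2 * (level c ε).val] 0
          (Domain.whole : Domain d).cavityNodes 0)) := by
  simp only [scaFreeEnergy, Timed.bind_val, Timed.sub, logCavity_val, Timed.pure_val, zero_sub,
    truncatedEnergy]
  rfl

theorem scaSurfacePressure_val (d : ℕ) (lam : ℝ) (a : Fin d → ℝ) (c : ℕ) (ε : ℝ) :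
    (scaSurfacePressure d lam a c ε).val
      = ∑ f : Face d, faceArea a f.1 / totalArea a
        * ∑ k ∈ Finset.range (level c ε).val,
          (truncatedEnergy lam (faceDomain f k).cavityNodes 0 (2 * (level c ε).val)
            - truncatedEnergy lam (Domain.whole : Domain d).cavityNodes 0
              (2 * (level c ε).val)) := by
  simp only [scaSurfacePressure, Timed.bind_val, Timed.sum_val, Timed.div, Timed.mul, Timed.sub,
    computeFaceArea_val, logCavity_val]
  rw [← Fin.sum_univ_def, ← Fin.sum_univ_def, Fintype.sum_prod_type]
  refine Finset.sum_congr rfl fun j _ => ?_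
  rw [Fintype.sum_bool, ← mul_add, ← Finset.sum_add_distrib]
  congr 1
  rw [← List.sum_toFinset _ List.nodup_range, List.toFinset_range]
  refine Finset.sum_congr rfl fun k _ => ?_
  simp only [truncatedEnergy, faceDomain, cond_true, cond_false, Pi.one_def]
  ring

theorem faceArea_pos {a : Fin d → ℝ} (ha : ∀ j, 0 < a j) (j : Fin d) : 0 < faceArea a j :=
  Finset.prod_pos fun k _ => mul_pos two_pos (ha k)

theorem totalArea_pos (hd : 0 < d) {a : Fin d → ℝ} (ha : ∀ j, 0 < a j) : 0 < totalArea a :=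
  Finset.sum_pos (fun j _ => faceArea_pos ha j) ⟨⟨0, hd⟩, Finset.mem_univ _⟩

theorem sum_face_faceArea (a : Fin d → ℝ) : ∑ f : Face d, faceArea a f.1 = 2 * totalArea a := by
  simp only [Fintype.sum_prod_type, Fintype.sum_bool, ← two_mul, ← Finset.mul_sum, totalArea]

namespace SpatialMixing

variable (hmix : SpatialMixing d lam C κ)

include hmix

theorem scaFreeEnergy_fst_le (hd : 0 < d) (c : ℕ) (ε : ℝ) :
    (scaFreeEnergy d lam c ε).val.1 ≤ (Domain.whole : Domain d).energy lam := by
  rw [scaFreeEnergy_val]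
  exact hmix.truncatedEnergy_two_mul_le_siteEnergy (Domain.whole.exposed_cavityNodes hd) _

theorem le_scaFreeEnergy_snd (hd : 0 < d) {c : ℕ} (hc : 0 < c) (ε : ℝ) :
    (Domain.whole : Domain d).energy lam ≤ (scaFreeEnergy d lam c ε).val.2 := by
  rw [scaFreeEnergy_val]
  exact hmix.siteEnergy_le_neg_log_iterate_zero (Domain.whole.exposed_cavityNodes hd)
    (Nat.mul_pos hc (Nat.succ_pos _))

theorem scaFreeEnergy_sub_le (hd : 0 < d) {c : ℕ} (hc : 0 < c) (ε : ℝ) :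
    (scaFreeEnergy d lam c ε).val.2 - (scaFreeEnergy d lam c ε).val.1
      ≤ C * κ ^ (level c ε).val := by
  have level_pos : 0 < (level c ε).val := Nat.mul_pos hc (Nat.succ_pos _)
  have gap := (abs_le.1 (hmix.abs_log_iterate_one_sub_log_iterate_zero_le
    ((Domain.whole : Domain d).exposed_cavityNodes hd) (2 * (level c ε).val - 1))).2
  rw [Nat.sub_add_cancel (by lia)] at gap
  have pow_le : C * κ ^ (2 * (level c ε).val - 1) ≤ C * κ ^ (level c ε).val :=
    mul_le_mul_of_nonneg_left
      (pow_le_pow_of_le_one hmix.rate_nonneg hmix.rate_lt_one.le (by lia))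
      (hmix.constant_nonneg hd)
  rw [scaFreeEnergy_val, truncatedEnergy]
  linarith

theorem abs_truncatedEnergy_sub_sub_faceExcess_le (hd : 0 < d) (f : Face d) (k t : ℕ) :
    |truncatedEnergy lam (faceDomain f k).cavityNodes 0 t
        - truncatedEnergy lam (Domain.whole : Domain d).cavityNodes 0 t - faceExcess lam f k|
      ≤ 2 * C * κ ^ t := by
  have face := hmix.abs_siteEnergy_sub_truncatedEnergy_le
    ((faceDomain f k).exposed_cavityNodes hd) t
  have whole := hmix.abs_siteEnergy_sub_truncatedEnergy_le
    ((Domain.whole : Domain d).exposed_cavityNodes hd) t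
  unfold faceExcess Domain.energy
  rw [abs_le] at *
  constructor <;> linarith

theorem abs_sum_truncatedEnergy_sub_tsum_le (hd : 0 < d) (f : Face d) (t : ℕ) :
    |∑ k ∈ Finset.range t, (truncatedEnergy lam (faceDomain f k).cavityNodes 0 (2 * t)
        - truncatedEnergy lam (Domain.whole : Domain d).cavityNodes 0 (2 * t))
        - ∑' k, faceExcess lam f k| ≤ 4 * C / (1 - κ) * κ ^ t := by
  have hC := hmix.constant_nonneg hd
  have hκ := hmix.rate_nonneg
  have one_sub_pos : 0 < 1 - κ := sub_pos.2 hmix.rate_lt_one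
  have truncation_error :
      |∑ k ∈ Finset.range t, (truncatedEnergy lam (faceDomain f k).cavityNodes 0 (2 * t)
        - truncatedEnergy lam (Domain.whole : Domain d).cavityNodes 0 (2 * t))
        - ∑ k ∈ Finset.range t, faceExcess lam f k| ≤ t * (2 * C * κ ^ (2 * t)) := by
    rw [← Finset.sum_sub_distrib]
    refine (Finset.abs_sum_le_sum_abs _ _).trans ((Finset.sum_le_card_nsmul _ _ _ fun k _ =>
      hmix.abs_truncatedEnergy_sub_sub_faceExcess_le hd f k (2 * t)).trans_eq ?_)
    rw [Finset.card_range, nsmul_eq_mul]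
  have tail : |∑ k ∈ Finset.range t, faceExcess lam f k - ∑' k, faceExcess lam f k|
      ≤ 2 * C * κ ^ t / (1 - κ) :=
    norm_sub_le_of_geometric_bound_of_hasSum hmix.rate_lt_one
      (fun k => hmix.abs_faceExcess_le hd f k) (hmix.summable_faceExcess hd f).hasSum t
  calc _ ≤ t * (2 * C * κ ^ (2 * t)) + 2 * C * κ ^ t / (1 - κ) :=
        (abs_sub_le _ _ _).trans (add_le_add truncation_error tail)
    _ = t * κ ^ t * (2 * C * κ ^ t) + 2 * C * κ ^ t / (1 - κ) := by
        rw [two_mul t, pow_add]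
        ring
    _ ≤ (1 - κ)⁻¹ * (2 * C * κ ^ t) + 2 * C * κ ^ t / (1 - κ) := by
        gcongr
        exact natCast_mul_pow_le hκ hmix.rate_lt_one t
    _ = 4 * C / (1 - κ) * κ ^ t := by
        field_simp
        ring

theorem abs_scaSurfacePressure_sub_le (hd : 0 < d) {a : Fin d → ℝ} (ha : ∀ j, 0 < a j)
    (c : ℕ) (ε : ℝ) :
    |(scaSurfacePressure d lam a c ε).val - surfaceSum lam a|
      ≤ 8 * C / (1 - κ) * κ ^ (level c ε).val := by
  have total_pos := totalArea_pos hd ha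
  rw [scaSurfacePressure_val, surfaceSum, ← Finset.sum_sub_distrib]
  calc _ ≤ ∑ f : Face d, faceArea a f.1 / totalArea a
        * (4 * C / (1 - κ) * κ ^ (level c ε).val) := by
        refine (Finset.abs_sum_le_sum_abs _ _).trans (Finset.sum_le_sum fun f _ => ?_)
        have weight_nonneg := (div_pos (faceArea_pos ha f.1) total_pos).le
        rw [← mul_sub, abs_mul, abs_of_nonneg weight_nonneg]
        exact mul_le_mul_of_nonneg_left (hmix.abs_sum_truncatedEnergy_sub_tsum_le hd f _)
          weight_nonneg
    _ = 8 * C / (1 - κ) * κ ^ (level c ε).val := by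
        rw [← Finset.sum_mul, ← Finset.sum_div, sum_face_faceArea,
          mul_div_cancel_right₀ _ total_pos.ne']
        ring

theorem exists_accurate_constant (hd : 0 < d) :
    ∃ c : ℕ, 0 < c ∧ ∀ ε : ℝ, 0 < ε →
      (scaFreeEnergy d lam c ε).val.2 - (scaFreeEnergy d lam c ε).val.1 ≤ ε ∧
      ∀ a : Fin d → ℝ, (∀ j, 0 < a j) →
        |(scaSurfacePressure d lam a c ε).val - surfaceSum lam a| ≤ ε := by
  obtain ⟨c, hc, accurate⟩ :=
    exists_level_constant (max C (8 * C / (1 - κ))) hmix.rate_nonneg hmix.rate_lt_one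
  have pow_nonneg (ε : ℝ) : 0 ≤ κ ^ (level c ε).val := pow_nonneg hmix.rate_nonneg _
  refine ⟨c, hc, fun ε hε => ⟨?_, fun a ha => ?_⟩⟩
  · exact (hmix.scaFreeEnergy_sub_le hd hc ε).trans
      ((mul_le_mul_of_nonneg_right (le_max_left _ _) (pow_nonneg ε)).trans (accurate ε hε))
  · exact (hmix.abs_scaSurfacePressure_sub_le hd ha c ε).trans
      ((mul_le_mul_of_nonneg_right (le_max_right _ _) (pow_nonneg ε)).trans (accurate ε hε))

end SpatialMixing

end Accuracy

end HardCore

theorem proposition2 (d : ℕ) (hd : 2 ≤ d) (lam : ℝ) (hlam : 0 < lam)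
    (hlam' : lam < (2 * (d : ℝ) - 1) ^ (2 * d - 1) / (2 * (d : ℝ) - 2) ^ (2 * d)) :
    ∃ (P : ℝ) (sP : (Fin d → ℝ) → ℝ),
      HardCore.HasFreeEnergy d lam P ∧
      (∀ a : Fin d → ℝ, (∀ j, 0 < a j) → HardCore.HasSurfacePressure d lam P a (sP a)) ∧
      ∃ c C : ℕ, ∀ ε : ℝ, 0 < ε →
        ((HardCore.scaFreeEnergy d lam c ε).val.1 ≤ P ∧
          P ≤ (HardCore.scaFreeEnergy d lam c ε).val.2 ∧
          (HardCore.scaFreeEnergy d lam c ε).val.2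
            - (HardCore.scaFreeEnergy d lam c ε).val.1 ≤ ε ∧
          ((HardCore.scaFreeEnergy d lam c ε).cost : ℝ) ≤ (max 2 (1 / ε)) ^ C) ∧
        ∀ a : Fin d → ℝ, (∀ j, 0 < a j) →
          |(HardCore.scaSurfacePressure d lam a c ε).val - sP a| ≤ ε ∧
          ((HardCore.scaSurfacePressure d lam a c ε).cost : ℝ) ≤ (max 2 (1 / ε)) ^ C := by
  have hd0 : 0 < d := by lia
  have hmix := HardCore.spatialMixing_of_lt_criticalActivity hd hlam.le
    (hlam'.trans_eq (HardCore.criticalActivity_two_mul_sub_one hd0).symm)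
  obtain ⟨c, hc, accurate⟩ := hmix.exists_accurate_constant hd0
  refine ⟨(HardCore.Domain.whole : HardCore.Domain d).energy lam, HardCore.surfaceSum lam,
    hmix.hasFreeEnergy hd0, fun a ha => hmix.hasSurfacePressure hd0 ha,
    c, 3 * (HardCore.costRate d * (3 * c + 2)), fun ε hε => ?_⟩
  obtain ⟨free_accurate, surface_accurate⟩ := accurate ε hε
  exact ⟨⟨hmix.scaFreeEnergy_fst_le hd0 c ε, hmix.le_scaFreeEnergy_snd hd0 hc ε, free_accurate,
      HardCore.scaFreeEnergy_cost_le_pow lam hc hε⟩,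
    fun a ha => ⟨surface_accurate a ha, HardCore.scaSurfacePressure_cost_le_pow lam hc hε a⟩⟩
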